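/- **Theorem (preservation of per-thread confidentiality by the compiler).** *Setting.* Fix types of locks $k$, program variables $v$, values (with a distinguished value $0$) and registers $r$. A shared variable is a lock $k$ or a program variable $v$; a memory $mem$ maps shared variables to values. A mode state $mds$ assigns to each of the modes $\mathbf{AsmNoW},\mathbf{AsmNoRW},\mathbf{GuarNoW},\mathbf{GuarNoRW}$ a set of shared variables. A local configuration is a triple $\langle tps, mds, mem\rangle$, where $tps$ is a thread-private state. The following parameters are given. - A classification $\mathcal L(mem,x)\in\{\mathrm{High},\mathrm{Low}\}$ and sets $\mathcal C(x)$ of control variables such that $\mathcal L(mem,x)$ depends only on the values of the variables in $\mathcal C(x)$. Put $\mathcal C=\bigcup_x\mathcal C(x)$; every $y\in\mathcal C$ is Low under every memory. - For each lock $k$, disjoint sets $\mathrm{NoW}(k),\mathrm{NoRW}(k)$ of program variables whose union is nonempty, such that no variable is governed by two different locks, and such that if $c\in\mathcal C(v)$ then $c\in\mathrm{NoW}(k)\iff v\in\mathrm{NoW}(k)$ and $c\in\mathrm{NoRW}(k)\iff v\in\mathrm{NoRW}(k)$. Lock variables are not control variables and are Low under every memory. - A predicate "held" on values, a value lockTrue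 for which it is true, and a value lockFalse for which it is false. - Two partial register allocation functions of a register record $\Phi$ and a set $A$ of registers in use. One returns a register outside $A$. The other, for a given variable $v$, returns a register outside $A$ that $\Phi$ records as containing $v$. *Security.* Write $mem_1=_{mds}mem_2$ if $mem_1(x)=mem_2(x)$ for every $x$ such that $x\in\mathcal C$, or $\mathcal L(mem_1,x)=\mathrm{Low}$ and $x\notin mds(\mathbf{AsmNoRW})$. A variable is writable if it is in neither $mds(\mathbf{AsmNoW})$ nor $mds(\mathbf{AsmNoRW})$. A relation $\mathcal B$ on local configurations is a *strong low bisimulation modulo modes* for a step relation $\to$ if the following hold. 1. $\mathcal B$ is symmetric. 2. Suppose $(\langle t_1,mds,m_1\rangle,\langle t_2,mds,m_2\rangle)\in\mathcal B$, $m_1'=_{mds}m_2'$, and every $x$ with $m_1(x)\ne m_1'(x)$ or $m_2(x)\neq m_2'(x)$ or $\mathcal L(m_1,x)\ne\mathcal L(m_1',x)$ is writable. Then $(\langle t_1,mds,m_1'\rangle,\langle t_2,mds,m_2'\rangle)\in\mathcal B$. 3. Whenever $(lc_1,lc_2)\in\mathcal B$ have the same mode state $mds$, their memories are related by $=_{mds}$,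 and each step $lc_1\to lc_1'$ is matched by some step $lc_2\to lc_2'$ with equal resulting mode states and $(lc_1',lc_2')\in\mathcal B$. For predicates $I$ on memories and $Q$ on relations, $\mathrm{ComSecure}(I,Q)\,(tps,mds)$ means: for all $mem_1=_{mds}mem_2$ that both satisfy $I$, there is a strong low bisimulation modulo modes $\mathcal B$ with $Q(\mathcal B)$ and $(\langle tps,mds,mem_1\rangle,\langle tps,mds,mem_2\rangle)\in\mathcal B$. - $\mathrm{NoLocksHeld}(mem)$: no lock variable has a value that counts as held in $mem$. - $\mathrm{InitMds}$: $\mathbf{GuarNoW}\mapsto\bigcup_k\mathrm{NoW}(k)$, $\mathbf{GuarNoRW}\mapsto\bigcup_k\mathrm{NoRW}(k)$, and both assumption modes $\mapsto\emptyset$. - $\mathrm{NoHighBranching}(\mathcal B)$: any two While configurations with equal mode states related by $\mathcal B$ have the same command $c$, and if the leftmost command of $c$ is $\mathtt{if}\ e\ c_1\ c_2$, then $e$ has the same value in both memories. - $\mathrm{PCSecurity}(\mathcal B)$: any two RISC configurations with equal mode states related by $\mathcal B$ have the same program counter and the same program text. *Source language.* Expressions are built from constants, program variables and binary operators on values. While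 commands are $\mathtt{stop}$ (terminated), $\mathtt{skip}$, $c;c$, $\mathtt{if}\ e\ c\ c$, $\mathtt{while}\ e\ c$, $v:=e$, $\mathtt{acquire}\ k$, $\mathtt{release}\ k$, with the usual small-step semantics: a guard is true iff its value is nonzero, $\mathtt{stop};c$ steps to $c$, and $\mathtt{while}\ e\ c$ steps to $\mathtt{if}\ e\ (c;\mathtt{while}\ e\ c)\ \mathtt{stop}$. If $k$ is not held, $\mathtt{acquire}\ k$ sets $k$ to lockTrue, adds $\mathrm{NoW}(k)$ to $\mathbf{AsmNoW}$ and $\mathrm{NoRW}(k)$ to $\mathbf{AsmNoRW}$, and removes them from $\mathbf{GuarNoW}$ and $\mathbf{GuarNoRW}$ respectively; if $k$ is held, it steps to itself. If all of $\mathrm{NoW}(k)$ is in $\mathbf{AsmNoW}$ and none of it in $\mathbf{GuarNoW}$, and likewise for $\mathrm{NoRW}(k)$, $\mathbf{AsmNoRW}$ and $\mathbf{GuarNoRW}$, then $\mathtt{release}\ k$ sets $k$ to lockFalse and makes the converse changes of modes; otherwise it steps to itself. *Target language.* RISC programs are lists of instructions, optionally labelled by natural numbers: load, store, jump, jump-if-zero,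 no-op, move constant, move register, binary operation, lock acquire and lock release (with the effect on memory and modes described above; the program counter stays put when the lock instruction has no effect). The thread-private state is $((pc,P),regs)$ with $P$ the program text. A jump goes to the first instruction with the given label, or to the end of the text if there is none; there is no step when $pc\geq |P|$. *Compiler.* A compilation record $C=(\Phi,S)$ consists of a register record $\Phi$ (a partial map from registers to expressions) and a pair $S=(S_1,S_2)$ of sets of program variables, the variables recorded as under $\mathbf{AsmNoW}$ and $\mathbf{AsmNoRW}$; $\mathrm{InitComprec}$ is the empty one. A variable is *stable* if it and all its control variables lie in $S_1\cup S_2$. $\mathrm{CompileCmd}\ C\ l\ nl\ c$ takes an initial record, an optional label for the first instruction and the next unused label. It returns an annotated text $PCs$ (a list of instructions paired with compilation records), an optional label $l'$ for the instruction following it, the next unused label $nl'$, a final record $C'$, and a failure flag. It is a single-pass compiler: - Expressions are evaluated into allocated registers, reusing a register recorded as containing the required variable; $\Phi$ is updated with the expression held by each register written. - $\mathtt{skip}$ becomes a no-op; assignments store the register and then drop the entries of $\Phi$ that mention the assigned variable; sequences are concatenated, passing on labels and records. - $\mathtt{if}\ e\ c_1\ c_2$ becomes $P_e$, $\mathtt{jz}\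 br\ r$, $P_1$, $\mathtt{jmp}\ ex$, $P_2$, $\mathtt{nop}$, where $P_2$ is labelled $br$ and $ex$ labels what follows; the final $\Phi$ keeps the entries on which both branches agree. - $\mathtt{while}\ e\ c$ becomes $lp{:}P_e$, $\mathtt{jz}\ ex\ r$, $P_c$, $\mathtt{jmp}\ lp$, where all entries of $\Phi$ are dropped before $e$ is compiled. - Lock commands become the corresponding instructions and update $S$ accordingly; on release, entries of $\Phi$ that mention a variable that is no longer stable are dropped. Compilation fails if register allocation fails, if $\mathtt{stop}$ has to be compiled, or if $\mathrm{CompilerInputReqs}\ C\ l\ nl\ c$ does not hold. The latter says: $c\neq\mathtt{stop}$; $l$, if present, is less than $nl$; all variables of expressions in $\Phi$ are stable; and, tracking $S$ through $c$, all expressions in $c$ use only stable variables, each variable assigned to is stable or governed by no lock, the two branches of each conditional end with the same $S$, and each loop body restores the $S$ it started with. *Statement.* Let $c$ be a While command, $regs$ an arbitrary register bank, $l$ an optional label and $nl$ a natural number. Suppose that $$\mathrm{ComSecure}(\mathrm{NoLocksHeld},\mathrm{NoHighBranching})\,(c,\mathrm{InitMds})$$ holds for the While semantics, that $\mathrm{CompileCmd}\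 \mathrm{InitComprec}\ l\ nl\ c=(PCs,l',nl',C',\mathrm{False})$ (compilation succeeds), and that $\mathrm{CompilerInputReqs}\ \mathrm{InitComprec}\ l\ nl\ c$ holds. Then, with $P$ the program text obtained from $PCs$ by dropping the annotations, $$\mathrm{ComSecure}(\mathrm{NoLocksHeld},\mathrm{PCSecurity})\,(((0,P),regs),\mathrm{InitMds})$$ holds for the RISC semantics. -/

import Mathlib

/-! ## Concurrent value-dependent noninterference, per thread

`X` is the type of shared variables, `V` the type of values, `T` the type of thread-private
states. -/

namespace WR

/-- Security classifications. -/
inductive Sec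
  | high
  | low

/-- Assume--guarantee access modes. -/
inductive Mode
  | asmNoW
  | asmNoRW
  | guarNoW
  | guarNoRW

/-- A mode state gives for each mode the set of shared variables on which it is active. -/
abbrev ModeState (X : Type*) := Mode → Set X

/-- A value-dependent classification of the shared variables, together with the control variables
of each variable. -/
structure Classification (X V : Type*) where
  /-- the classification of a variable under a given memory -/
  dma : (X → V) → X → Sec
  /-- the control variables of a variable -/
  cvars : X → Set X
  /-- the classification of a variable depends only on its control variables -/
  dma_cvars : ∀ (mem₁ mem₂ : X → V) (x : X),
    (∀ y ∈ cvars x, mem₁ y = mem₂ y) → dma mem₁ x = dma mem₂ x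
  /-- control variables are statically low -/
  dma_control : ∀ (mem : X → V) (x y : X), y ∈ cvars x → dma mem y = Sec.low

/-- The set of all control variables. -/
def Classification.control {X V : Type*} (cl : Classification X V) : Set X :=
  {y | ∃ x, y ∈ cl.cvars x}

/-- The local configuration of a thread. -/
structure LocalConf (T X V : Type*) where
  /-- thread-private state -/
  tps : T
  /-- mode state -/
  mds : ModeState X
  /-- shared memory -/
  mem : X → V

def Readable {X : Type*} (mds : ModeState X) (x : X) : Prop :=
  x ∉ mds Mode.asmNoRW

def Writable {X : Type*} (mds : ModeState X) (x : X) : Prop :=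
  x ∉ mds Mode.asmNoW ∧ x ∉ mds Mode.asmNoRW

/-- Low-equivalence of memories modulo a mode state. -/
def LowEqMod {X V : Type*} (cl : Classification X V) (mds : ModeState X)
    (mem₁ mem₂ : X → V) : Prop :=
  ∀ x, (x ∈ cl.control ∨ (cl.dma mem₁ x = Sec.low ∧ Readable mds x)) → mem₁ x = mem₂ x

/-- Closedness under globally consistent changes. -/
def CgConsistent {T X V : Type*} (cl : Classification X V)
    (B : LocalConf T X V → LocalConf T X V → Prop) : Prop :=
  ∀ (tps₁ : T) (mem₁ : X → V) (tps₂ : T) (mem₂ : X → V) (mds : ModeState X),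
    B ⟨tps₁, mds, mem₁⟩ ⟨tps₂, mds, mem₂⟩ →
    ∀ mem₁' mem₂' : X → V,
      (∀ x, (mem₁ x ≠ mem₁' x ∨ mem₂ x ≠ mem₂' x ∨ cl.dma mem₁ x ≠ cl.dma mem₁' x) →
        Writable mds x) →
      LowEqMod cl mds mem₁' mem₂' →
      B ⟨tps₁, mds, mem₁'⟩ ⟨tps₂, mds, mem₂'⟩

/-- Strong low bisimulations modulo modes, for the evaluation step relation `step`. -/
def StrongLowBisimMM {T X V : Type*} (cl : Classification X V)
    (step : LocalConf T X V → LocalConf T X V → Prop)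
    (B : LocalConf T X V → LocalConf T X V → Prop) : Prop :=
  CgConsistent cl B ∧
  (∀ lc₁ lc₂, B lc₁ lc₂ → B lc₂ lc₁) ∧
  ∀ lc₁ lc₂, B lc₁ lc₂ → lc₁.mds = lc₂.mds →
    LowEqMod cl lc₁.mds lc₁.mem lc₂.mem ∧
    ∀ lc₁', step lc₁ lc₁' → ∃ lc₂', step lc₂ lc₂' ∧ lc₁'.mds = lc₂'.mds ∧ B lc₁' lc₂'

/-- Per-thread compositional security, with initialisation requirement `INIT` on memories and
extra requirement `BISIMREQS` on the witness bisimulations. -/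
def ComSecure {T X V : Type*} (cl : Classification X V)
    (step : LocalConf T X V → LocalConf T X V → Prop)
    (INIT : (X → V) → Prop)
    (BISIMREQS : (LocalConf T X V → LocalConf T X V → Prop) → Prop)
    (tps : T) (mds : ModeState X) : Prop :=
  ∀ mem₁ mem₂ : X → V,
    LowEqMod cl mds mem₁ mem₂ ∧ INIT mem₁ ∧ INIT mem₂ →
    ∃ B : LocalConf T X V → LocalConf T X V → Prop,
      StrongLowBisimMM cl step B ∧ BISIMREQS B ∧ B ⟨tps, mds, mem₁⟩ ⟨tps, mds, mem₂⟩

/-! ## Locks and locking disciplines -/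

/-- Shared variables: lock variables and program variables. -/
inductive Shared (L X : Type*)
  | lock (k : L)
  | var (v : X)

/-- Shared memories. -/
abbrev Mem (L X V : Type*) := Shared L X → V

/-- The parameters supplied by the program developer (the lock interpretation, the encoding of the
status of a lock by values, and the classification), with the restrictions imposed on them. -/
structure Discipline (L X V : Type*) where
  /-- variables to which holding the lock grants exclusive permission to write -/
  noW : L → Set X
  /-- variables to which holding the lock grants exclusive permission to read and write -/
  noRW : L → Set X
  /-- whether a value of a lock variable means that the lock is held -/
  evLock : V → Prop
  lockTrue : V
  lockFalse : V
  evLock_true : evLock lockTrue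
  evLock_false : ¬ evLock lockFalse
  /-- the classification function and control variables -/
  cl : Classification (Shared L X) V
  /-- lock variables are not control variables -/
  lock_not_control : ∀ k, Shared.lock k ∉ cl.control
  /-- lock variables are statically low -/
  lock_low : ∀ k mem, cl.dma mem (Shared.lock k) = Sec.low
  /-- variables and their control variables are governed by the same locks -/
  cvars_governed : ∀ c v k, Shared.var c ∈ cl.cvars (Shared.var v) →
    (c ∈ noW k ↔ v ∈ noW k) ∧ (c ∈ noRW k ↔ v ∈ noRW k)
  /-- no variable is governed by two locks -/
  governed_unique : ∀ v k, v ∈ noW k ∪ noRW k → ∀ k', v ∈ noW k' ∪ noRW k' → k' = k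
  /-- there are no vacuous locks -/
  nonvacuous : ∀ k, noW k ∪ noRW k ≠ ∅
  /-- the two sets governed by a lock do not overlap -/
  disjoint : ∀ k, noW k ∩ noRW k = ∅

section Locks

variable {L X V : Type*} (D : Discipline L X V)

/-- The effect on the mode state of acquiring a lock. -/
def lockAcqUpd (mds : ModeState (Shared L X)) (k : L) : ModeState (Shared L X)
  | Mode.guarNoW => mds Mode.guarNoW \ (Shared.var '' D.noW k)
  | Mode.asmNoW => mds Mode.asmNoW ∪ (Shared.var '' D.noW k)
  | Mode.guarNoRW => mds Mode.guarNoRW \ (Shared.var '' D.noRW k)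
  | Mode.asmNoRW => mds Mode.asmNoRW ∪ (Shared.var '' D.noRW k)

/-- The effect on the mode state of releasing a lock. -/
def lockRelUpd (mds : ModeState (Shared L X)) (k : L) : ModeState (Shared L X)
  | Mode.guarNoW => mds Mode.guarNoW ∪ (Shared.var '' D.noW k)
  | Mode.asmNoW => mds Mode.asmNoW \ (Shared.var '' D.noW k)
  | Mode.guarNoRW => mds Mode.guarNoRW ∪ (Shared.var '' D.noRW k)
  | Mode.asmNoRW => mds Mode.asmNoRW \ (Shared.var '' D.noRW k)

/-- The mode state is consistent with holding the lock `k`. -/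
def LockHeldMdsCorrect (mds : ModeState (Shared L X)) (k : L) : Prop :=
  ∀ x : X,
    (x ∈ D.noW k → Shared.var x ∉ mds Mode.guarNoW ∧ Shared.var x ∈ mds Mode.asmNoW) ∧
    (x ∈ D.noRW k → Shared.var x ∉ mds Mode.guarNoRW ∧ Shared.var x ∈ mds Mode.asmNoRW)

/-- No locks are held. -/
def NoLocksHeld (mem : Mem L X V) : Prop :=
  ∀ k, ¬ D.evLock (mem (Shared.lock k))

/-- The initial mode state: all guarantees, no assumptions. -/
def initMds : ModeState (Shared L X)
  | Mode.guarNoW => ⋃ k, Shared.var '' D.noW k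
  | Mode.guarNoRW => ⋃ k, Shared.var '' D.noRW k
  | Mode.asmNoW => ∅
  | Mode.asmNoRW => ∅

end Locks

/-! ## The source language -/

/-- Expressions: constants, program variables, and binary operators on values. -/
inductive Expr (X V : Type*)
  | const (n : V)
  | var (v : X)
  | op (f : V → V → V) (e₁ e₂ : Expr X V)

/-- The value of an expression. -/
def Expr.eval {L X V : Type*} (mem : Mem L X V) : Expr X V → V
  | .const n => n
  | .var v => mem (Shared.var v)
  | .op f e₁ e₂ => f (e₁.eval mem) (e₂.eval mem)

/-- The program variables mentioned in an expression. -/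
def Expr.vars {X V : Type*} : Expr X V → Set X
  | .const _ => ∅
  | .var v => {v}
  | .op _ e₁ e₂ => e₁.vars ∪ e₂.vars

/-- While commands; `halt` is the terminated command. -/
inductive Cmd (L X V : Type*)
  | halt
  | skip
  | seq (c₁ c₂ : Cmd L X V)
  | ite (e : Expr X V) (c₁ c₂ : Cmd L X V)
  | loop (e : Expr X V) (c : Cmd L X V)
  | assign (v : X) (e : Expr X V)
  | lockAcq (k : L)
  | lockRel (k : L)

/-- The leftmost command in a sequence of `;`-separated commands. -/
def Cmd.leftmost {L X V : Type*} : Cmd L X V → Cmd L X V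
  | .seq c₁ _ => c₁.leftmost
  | c => c

open Classical in
/-- Small-step semantics of While. A guard counts as true if and only if its value is nonzero. -/
inductive WhileStep {L X V : Type*} [Zero V] (D : Discipline L X V) :
    LocalConf (Cmd L X V) (Shared L X) V → LocalConf (Cmd L X V) (Shared L X) V → Prop
  | skip (mds mem) : WhileStep D ⟨.skip, mds, mem⟩ ⟨.halt, mds, mem⟩
  | assign (v e mds mem) :
      WhileStep D ⟨.assign v e, mds, mem⟩
        ⟨.halt, mds, Function.update mem (Shared.var v) (e.eval mem)⟩
  | seq (c₁ c₁' c₂ mds mds' mem mem') :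
      WhileStep D ⟨c₁, mds, mem⟩ ⟨c₁', mds', mem'⟩ →
      WhileStep D ⟨.seq c₁ c₂, mds, mem⟩ ⟨.seq c₁' c₂, mds', mem'⟩
  | seqHalt (c mds mem) : WhileStep D ⟨.seq .halt c, mds, mem⟩ ⟨c, mds, mem⟩
  | iteTrue (e c₁ c₂ mds mem) : e.eval mem ≠ 0 →
      WhileStep D ⟨.ite e c₁ c₂, mds, mem⟩ ⟨c₁, mds, mem⟩
  | iteFalse (e c₁ c₂ mds mem) : e.eval mem = 0 →
      WhileStep D ⟨.ite e c₁ c₂, mds, mem⟩ ⟨c₂, mds, mem⟩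
  | loop (e c mds mem) :
      WhileStep D ⟨.loop e c, mds, mem⟩ ⟨.ite e (.seq c (.loop e c)) .halt, mds, mem⟩
  | lockAcq (k mds mem) : ¬ D.evLock (mem (Shared.lock k)) →
      WhileStep D ⟨.lockAcq k, mds, mem⟩
        ⟨.halt, lockAcqUpd D mds k, Function.update mem (Shared.lock k) D.lockTrue⟩
  | lockSpin (k mds mem) : D.evLock (mem (Shared.lock k)) →
      WhileStep D ⟨.lockAcq k, mds, mem⟩ ⟨.lockAcq k, mds, mem⟩
  | lockRel (k mds mem) : LockHeldMdsCorrect D mds k →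
      WhileStep D ⟨.lockRel k, mds, mem⟩
        ⟨.halt, lockRelUpd D mds k, Function.update mem (Shared.lock k) D.lockFalse⟩
  | lockInvalid (k mds mem) : ¬ LockHeldMdsCorrect D mds k →
      WhileStep D ⟨.lockRel k, mds, mem⟩ ⟨.lockRel k, mds, mem⟩

/-- The extra requirement on bisimulations that bans branching on high values. -/
def NoHighBranching {L X V : Type*}
    (B : LocalConf (Cmd L X V) (Shared L X) V → LocalConf (Cmd L X V) (Shared L X) V → Prop) :
    Prop :=
  ∀ (c c' : Cmd L X V) (mds : ModeState (Shared L X)) (mem mem' : Mem L X V),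
    B ⟨c, mds, mem⟩ ⟨c', mds, mem'⟩ →
    c = c' ∧ ∀ e c₁ c₂, c.leftmost = .ite e c₁ c₂ → e.eval mem = e.eval mem'

/-! ## The target language -/

/-- Bodies of RISC instructions; labels are natural numbers. -/
inductive InstrBody (L X V R : Type*)
  | load (r : R) (v : X)
  | store (v : X) (r : R)
  | jmp (l : ℕ)
  | jz (l : ℕ) (r : R)
  | nop
  | moveK (r : R) (n : V)
  | moveR (r r' : R)
  | op (f : V → V → V) (r r' : R)
  | lockAcq (k : L)
  | lockRel (k : L)

/-- An optionally labelled RISC instruction. -/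
abbrev Instr (L X V R : Type*) := Option ℕ × InstrBody L X V R

/-- RISC thread-private states `((pc, P), regs)`. -/
abbrev RiscState (L X V R : Type*) := (ℕ × List (Instr L X V R)) × (R → V)

/-- The position of the first instruction labelled `l`. If there is none, this is the length of the
text, so that jumping there terminates the program. -/
def resolve {L X V R : Type*} (P : List (Instr L X V R)) (l : ℕ) : ℕ :=
  P.findIdx fun i => i.1 == some l

open Classical in
/-- Small-step semantics of RISC. There is no step if `pc` is outside the program text. -/
inductive RiscStep {L X V R : Type*} [Zero V] (D : Discipline L X V) :
    LocalConf (RiscState L X V R) (Shared L X) V →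
    LocalConf (RiscState L X V R) (Shared L X) V → Prop
  | load (pc P regs mds mem lab r v) : P[pc]? = some (lab, .load r v) →
      RiscStep D ⟨((pc, P), regs), mds, mem⟩
        ⟨((pc + 1, P), Function.update regs r (mem (Shared.var v))), mds, mem⟩
  | store (pc P regs mds mem lab v r) : P[pc]? = some (lab, .store v r) →
      RiscStep D ⟨((pc, P), regs), mds, mem⟩
        ⟨((pc + 1, P), regs), mds, Function.update mem (Shared.var v) (regs r)⟩
  | jmp (pc P regs mds mem lab l) : P[pc]? = some (lab, .jmp l) →
      RiscStep D ⟨((pc, P), regs), mds, mem⟩ ⟨((resolve P l, P), regs), mds, mem⟩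
  | jzTrue (pc P regs mds mem lab l r) : P[pc]? = some (lab, .jz l r) → regs r = 0 →
      RiscStep D ⟨((pc, P), regs), mds, mem⟩ ⟨((resolve P l, P), regs), mds, mem⟩
  | jzFalse (pc P regs mds mem lab l r) : P[pc]? = some (lab, .jz l r) → regs r ≠ 0 →
      RiscStep D ⟨((pc, P), regs), mds, mem⟩ ⟨((pc + 1, P), regs), mds, mem⟩
  | nop (pc P regs mds mem lab) : P[pc]? = some (lab, .nop) →
      RiscStep D ⟨((pc, P), regs), mds, mem⟩ ⟨((pc + 1, P), regs), mds, mem⟩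
  | moveK (pc P regs mds mem lab r n) : P[pc]? = some (lab, .moveK r n) →
      RiscStep D ⟨((pc, P), regs), mds, mem⟩
        ⟨((pc + 1, P), Function.update regs r n), mds, mem⟩
  | moveR (pc P regs mds mem lab r r') : P[pc]? = some (lab, .moveR r r') →
      RiscStep D ⟨((pc, P), regs), mds, mem⟩
        ⟨((pc + 1, P), Function.update regs r (regs r')), mds, mem⟩
  | op (pc P regs mds mem lab f r r') : P[pc]? = some (lab, .op f r r') →
      RiscStep D ⟨((pc, P), regs), mds, mem⟩
        ⟨((pc + 1, P), Function.update regs r (f (regs r) (regs r'))), mds, mem⟩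
  | lockAcq (pc P regs mds mem lab k) : P[pc]? = some (lab, .lockAcq k) →
      ¬ D.evLock (mem (Shared.lock k)) →
      RiscStep D ⟨((pc, P), regs), mds, mem⟩
        ⟨((pc + 1, P), regs), lockAcqUpd D mds k,
          Function.update mem (Shared.lock k) D.lockTrue⟩
  | lockSpin (pc P regs mds mem lab k) : P[pc]? = some (lab, .lockAcq k) →
      D.evLock (mem (Shared.lock k)) →
      RiscStep D ⟨((pc, P), regs), mds, mem⟩ ⟨((pc, P), regs), mds, mem⟩
  | lockRel (pc P regs mds mem lab k) : P[pc]? = some (lab, .lockRel k) →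
      LockHeldMdsCorrect D mds k →
      RiscStep D ⟨((pc, P), regs), mds, mem⟩
        ⟨((pc + 1, P), regs), lockRelUpd D mds k,
          Function.update mem (Shared.lock k) D.lockFalse⟩
  | lockInvalid (pc P regs mds mem lab k) : P[pc]? = some (lab, .lockRel k) →
      ¬ LockHeldMdsCorrect D mds k →
      RiscStep D ⟨((pc, P), regs), mds, mem⟩ ⟨((pc, P), regs), mds, mem⟩

/-- The pc-security requirement on bisimulations between RISC configurations. -/
def PCSecurity {L X V R : Type*}
    (B : LocalConf (RiscState L X V R) (Shared L X) V →
      LocalConf (RiscState L X V R) (Shared L X) V → Prop) : Prop :=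
  ∀ (pc pc' : ℕ) (P P' : List (Instr L X V R)) (regs regs' : R → V)
    (mds : ModeState (Shared L X)) (mem mem' : Mem L X V),
    B ⟨((pc, P), regs), mds, mem⟩ ⟨((pc', P'), regs'), mds, mem'⟩ → pc = pc' ∧ P = P'

/-! ## The compiler -/

/-- Register records: the expression that a register is known to hold the value of. -/
abbrev RegRec (X V R : Type*) := R → Option (Expr X V)

/-- Assumption records: the program variables with an active assumption of no writes, respectively
of no reads and writes, by other threads. -/
abbrev AsmRec (X : Type*) := Set X × Set X

/-- Compilation records. -/
abbrev CompRec (X V R : Type*) := RegRec X V R × AsmRec X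

/-- The empty compilation record. -/
def initCompRec (X V R : Type*) : CompRec X V R := (fun _ => none, (∅, ∅))

/-- A register allocation scheme. Given the register record and the set of registers needed for
the current expression, `alloc` yields a fresh register, and `allocCached` a register recorded as
containing the given variable. Either may fail. -/
structure RegAlloc (X V R : Type*) where
  alloc : RegRec X V R → Set R → Option R
  allocCached : RegRec X V R → Set R → X → Option R
  alloc_spec : ∀ Φ A r, alloc Φ A = some r → r ∉ A
  allocCached_spec : ∀ Φ A v r, allocCached Φ A v = some r → r ∉ A ∧ Φ r = some (.var v)

section Compiler

variable {L X V R : Type*} (D : Discipline L X V)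

/-- Stability of a program variable according to an assumption record. -/
def VarStable (S : AsmRec X) (v : X) : Prop :=
  v ∈ S.1 ∪ S.2 ∧ ∀ v', Shared.var v' ∈ D.cl.cvars (Shared.var v) → v' ∈ S.1 ∪ S.2

/-- Stability of the register record in a compilation record. -/
def RegRecStable (C : CompRec X V R) : Prop :=
  ∀ r e, C.1 r = some e → ∀ v ∈ e.vars, VarStable D C.2 v

/-- The assumption record after acquiring a lock. -/
def AsmRec.acq (S : AsmRec X) (k : L) : AsmRec X := (S.1 ∪ D.noW k, S.2 ∪ D.noRW k)

/-- The assumption record after releasing a lock. -/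
def AsmRec.rel (S : AsmRec X) (k : L) : AsmRec X := (S.1 \ D.noW k, S.2 \ D.noRW k)

/-- The assumption record after running a command that passes the stability checks. -/
def asmAfter : Cmd L X V → AsmRec X → AsmRec X
  | .halt, S => S
  | .skip, S => S
  | .seq c₁ c₂, S => asmAfter c₂ (asmAfter c₁ S)
  | .ite _ c₁ _, S => asmAfter c₁ S
  | .loop _ _, S => S
  | .assign _ _, S => S
  | .lockAcq k, S => S.acq D k
  | .lockRel k, S => S.rel D k

/-- The stability checks: only expressions on stable variables are used, variables assigned to are
stable or not governed by any lock, both branches of a conditional end with the same assumptions,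
and loop bodies restore the assumptions made on entry. -/
def StabilityChecks : Cmd L X V → AsmRec X → Prop
  | .halt, _ => True
  | .skip, _ => True
  | .seq c₁ c₂, S => StabilityChecks c₁ S ∧ StabilityChecks c₂ (asmAfter D c₁ S)
  | .ite e c₁ c₂, S => (∀ v ∈ e.vars, VarStable D S v) ∧
      StabilityChecks c₁ S ∧ StabilityChecks c₂ S ∧ asmAfter D c₁ S = asmAfter D c₂ S
  | .loop e c, S => (∀ v ∈ e.vars, VarStable D S v) ∧
      StabilityChecks c S ∧ asmAfter D c S = S
  | .assign v e, S => (∀ x ∈ e.vars, VarStable D S x) ∧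
      (VarStable D S v ∨ ∀ k, v ∉ D.noW k ∪ D.noRW k)
  | .lockAcq _, _ => True
  | .lockRel _, _ => True

/-- The requirements on the inputs to the compiler. -/
def CompilerInputReqs (C : CompRec X V R) (l : Option ℕ) (nl : ℕ) (c : Cmd L X V) : Prop :=
  StabilityChecks D c C.2 ∧ RegRecStable D C ∧ c ≠ .halt ∧ ∀ x, l = some x → x < nl

open Classical in
/-- Remove the entries that mention a variable in `U`. -/
noncomputable def RegRec.purge (Φ : RegRec X V R) (U : Set X) : RegRec X V R :=
  fun r => (Φ r).bind fun e => if ∃ v ∈ e.vars, v ∈ U then none else some e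

open Classical in
/-- The entries on which two register records agree. -/
noncomputable def RegRec.meet (Φ Φ' : RegRec X V R) : RegRec X V R :=
  fun r => if Φ r = Φ' r then Φ r else none

/-- RISC program texts annotated with the compilation record holding before each instruction. -/
abbrev CompText (L X V R : Type*) := List (Instr L X V R × CompRec X V R)

open Classical in
/-- The expression compiler. On success it returns the compiled text, the register that will hold
the value of the expression, and the final compilation record; `none` stands for failure of the
register allocation. The label `l` is put on the first instruction, if there is one. -/
noncomputable def compileExpr (ra : RegAlloc X V R) (C : CompRec X V R) (A : Set R)
    (l : Option ℕ) : Expr X V → Option (CompText L X V R × R × CompRec X V R)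
  | .const n =>
    match ra.alloc C.1 A with
    | some r => some ([((l, .moveK r n), C)], r, (Function.update C.1 r (some (.const n)), C.2))
    | none => none
  | .var v =>
    match ra.allocCached C.1 A v with
    | some r => some ([], r, C)
    | none =>
      match ra.alloc C.1 A with
      | some r => some ([((l, .load r v), C)], r, (Function.update C.1 r (some (.var v)), C.2))
      | none => none
  | .op f e₁ e₂ =>
    match compileExpr ra C A l e₁ with
    | none => none
    | some (P₁, r₁, C₁) =>
      match compileExpr ra C₁ (A ∪ {r₁}) (if P₁.isEmpty then l else none) e₂ with
      | none => none
      | some (P₂, r₂, C₂) =>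
        some (P₁ ++ P₂ ++ [((if (P₁ ++ P₂).isEmpty then l else none, .op f r₁ r₂), C₂)], r₁,
          (Function.update C₂.1 r₁ (some (.op f e₁ e₂)), C₂.2))

/-- The recursive part of the compiler. Its arguments are the initial compilation record, the label
(if any) to be put on the first instruction, and the next unused label. On success it returns the
annotated text, the label (if any) that the instruction following the text has to carry, the next
unused label, and the final compilation record; `none` stands for failure. -/
noncomputable def compileCore (ra : RegAlloc X V R) :
    CompRec X V R → Option ℕ → ℕ → Cmd L X V →
    Option (CompText L X V R × Option ℕ × ℕ × CompRec X V R)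
  | _, _, _, .halt => none
  | C, l, nl, .skip => some ([((l, .nop), C)], none, nl, C)
  | C, l, nl, .seq c₁ c₂ =>
    match compileCore ra C l nl c₁ with
    | none => none
    | some (P₁, l₁, nl₁, C₁) =>
      match compileCore ra C₁ l₁ nl₁ c₂ with
      | none => none
      | some (P₂, l₂, nl₂, C₂) => some (P₁ ++ P₂, l₂, nl₂, C₂)
  | C, l, nl, .ite e c₁ c₂ =>
    match compileExpr ra C ∅ l e with
    | none => none
    | some (Pe, r, C₁) =>
      -- the labels of the second branch and of the exit are `nl` and `nl + 1`
      match compileCore ra C₁ none (nl + 2) c₁ with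
      | none => none
      | some (P₁, l₁, nl₁, C₂) =>
        match compileCore ra C₁ (some nl) nl₁ c₂ with
        | none => none
        | some (P₂, l₂, nl₂, C₃) =>
          some (Pe ++ [((if Pe.isEmpty then l else none, .jz nl r), C₁)] ++
              P₁ ++ [((l₁, .jmp (nl + 1)), C₂)] ++ P₂ ++ [((l₂, .nop), C₃)],
            some (nl + 1), nl₂, (C₂.1.meet C₃.1, C₂.2))
  | C, l, nl, .loop e c =>
    -- the label of the loop head is `l` if there is one, and otherwise fresh
    let lp := l.getD nl
    let ex := if l.isSome then nl else nl + 1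
    -- all register entries are flushed, so that the text of `e` is nonempty
    match compileExpr ra ((fun _ => none, C.2) : CompRec X V R) ∅ (some lp) e with
    | none => none
    | some (Pe, r, C₁) =>
      match compileCore ra C₁ none (ex + 1) c with
      | none => none
      | some (P, l', nl', C₂) =>
        some (Pe ++ [((none, .jz ex r), C₁)] ++ P ++ [((l', .jmp lp), C₂)],
          some ex, nl', C₁)
  | C, l, nl, .assign v e =>
    match compileExpr ra C ∅ l e with
    | none => none
    | some (Pe, r, C₁) =>
      some (Pe ++ [((if Pe.isEmpty then l else none, .store v r), C₁)], none, nl,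
        (C₁.1.purge {v}, C₁.2))
  | C, l, nl, .lockAcq k => some ([((l, .lockAcq k), C)], none, nl, (C.1, C.2.acq D k))
  | C, l, nl, .lockRel k =>
    -- entries that mention variables becoming unstable are flushed
    some ([((l, .lockRel k), C)], none, nl,
      (C.1.purge {v | ¬ VarStable D (C.2.rel D k) v}, C.2.rel D k))

open Classical in
/-- The compiler. The last component of the result tells whether the compilation failed, which is
the case if the input requirements are violated. -/
noncomputable def compileCmd (ra : RegAlloc X V R) (C : CompRec X V R) (l : Option ℕ) (nl : ℕ)
    (c : Cmd L X V) : CompText L X V R × Option ℕ × ℕ × CompRec X V R × Bool :=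
  if CompilerInputReqs D C l nl c then
    match compileCore D ra C l nl c with
    | some (PCs, l', nl', C') => (PCs, l', nl', C', false)
    | none => ([], none, nl, C, true)
  else ([], none, nl, C, true)

end Compiler

end WR

/-! Compiled code acts on the same memory and modes as its source, so a bisimulation for the target
can be read off one for the source. By `NoHighBranching`, source runs related under equal modes have
the same residual command and agree on every guard about to be decided. Such a pair is one command
with two memories (`Lockstep`). Two RISC configurations with equal text, program counter and modes
are related when some residual command is executed by the code from that point on (`Sim`), some
compilation record describes both register banks correctly (`RecOK`), and the source bisimulation
relates the residual command under the two memories.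

Each RISC step is then matched (`Sim.matched`). It either realises a While step, which the source
bisimulation matches, or changes only registers and program counter and needs no While step. While
steps without RISC counterpart (discarding a finished first component, unfolding a loop) are taken
silently in both runs. Conditional jumps go the same way because the tested register holds the value
of the guard, on which the runs agree. Low equivalence is inherited from the source. Interference by
the environment is harmless since recorded expressions use only stable variables, which are not
writable (`RecOK.of_writable`). `PCSecurity` is built into the relation. This gives
`comSecure_of_sim`.

`Sim` speaks only of text, command and records, never of a run, so it is established by induction on
the command (`compileCore_sim`). Two things need care: jumps must reach the intended positions,
which rests on freshness of labels (`compileCore_labels`), and registers still in use must not be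
overwritten (`compileExpr_straight`). -/

namespace WR

/-! ## Simulation of While commands by RISC code -/

section Simulation

variable {L X V R : Type*} (D : Discipline L X V)

/-- `C'` records at most the register contents that `C` does, under the same assumptions. -/
def CompRec.Le (C' C : CompRec X V R) : Prop :=
  C'.2 = C.2 ∧ ∀ r e, C'.1 r = some e → C.1 r = some e

open Classical in
/-- Symbolic execution of straight-line code on stable variables. -/
inductive Straight (P : List (Instr L X V R)) (S : AsmRec X) :
    ℕ → RegRec X V R → ℕ → RegRec X V R → Prop
  | refl (pc Φ) : Straight P S pc Φ pc Φ
  | load (pc Φ lab r v pc' Φ') : P[pc]? = some (lab, .load r v) → VarStable D S v →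
      Straight P S (pc + 1) (Function.update Φ r (some (.var v))) pc' Φ' →
      Straight P S pc Φ pc' Φ'
  | moveK (pc Φ lab r n pc' Φ') : P[pc]? = some (lab, .moveK r n) →
      Straight P S (pc + 1) (Function.update Φ r (some (.const n))) pc' Φ' →
      Straight P S pc Φ pc' Φ'
  | op (pc Φ lab f r₁ r₂ e₁ e₂ pc' Φ') : P[pc]? = some (lab, .op f r₁ r₂) →
      Φ r₁ = some e₁ → Φ r₂ = some e₂ →
      Straight P S (pc + 1) (Function.update Φ r₁ (some (.op f e₁ e₂))) pc' Φ' →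
      Straight P S pc Φ pc' Φ'

theorem Straight.trans {P : List (Instr L X V R)} {S : AsmRec X} {pc₁ pc₂ pc₃ : ℕ}
    {Φ₁ Φ₂ Φ₃ : RegRec X V R} (h : Straight D P S pc₁ Φ₁ pc₂ Φ₂)
    (h' : Straight D P S pc₂ Φ₂ pc₃ Φ₃) : Straight D P S pc₁ Φ₁ pc₃ Φ₃ := by
  induction h with
  | refl => exact h'
  | load _ _ _ _ _ _ _ hi hv _ ih => exact .load _ _ _ _ _ _ _ hi hv (ih h')
  | moveK _ _ _ _ _ _ _ hi _ ih => exact .moveK _ _ _ _ _ _ _ hi (ih h')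
  | op _ _ _ _ _ _ _ _ _ _ hi h₁ h₂ _ ih => exact .op _ _ _ _ _ _ _ _ _ _ hi h₁ h₂ (ih h')

/-- `Sim D P c pc C pc' C'`: started at `pc` with record `C`, the text `P` executes the command `c`
and arrives at `pc'` with record `C'`. -/
inductive Sim (P : List (Instr L X V R)) :
    Cmd L X V → ℕ → CompRec X V R → ℕ → CompRec X V R → Prop
  | halt (pc C) : Sim P .halt pc C pc C
  | skip (pc C lab) : P[pc]? = some (lab, .nop) → Sim P .skip pc C (pc + 1) C
  | assign (pc Φ S pc₁ Φ₁ lab v e r) : Straight D P S pc Φ pc₁ Φ₁ →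
      P[pc₁]? = some (lab, .store v r) → Φ₁ r = some e →
      Sim P (.assign v e) pc (Φ, S) (pc₁ + 1) (Φ₁.purge {v}, S)
  | seq (c₁ c₂ pc C pc₁ C₁ pc₂ C₂) : Sim P c₁ pc C pc₁ C₁ → Sim P c₂ pc₁ C₁ pc₂ C₂ →
      Sim P (.seq c₁ c₂) pc C pc₂ C₂
  | ite (e c₁ c₂ pc Φ S pc₁ Φ₁ lab l r pc' C') : Straight D P S pc Φ pc₁ Φ₁ →
      P[pc₁]? = some (lab, .jz l r) → Φ₁ r = some e →
      Sim P c₁ (pc₁ + 1) (Φ₁, S) pc' C' → Sim P c₂ (resolve P l) (Φ₁, S) pc' C' →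
      Sim P (.ite e c₁ c₂) pc (Φ, S) pc' C'
  | loop (e c pc Φ S pc₁ Φ₁ lab l r Φ₂) :
      Straight D P S pc (fun _ => none) pc₁ Φ₁ →
      P[pc₁]? = some (lab, .jz l r) → Φ₁ r = some e →
      Sim P c (pc₁ + 1) (Φ₁, S) pc (Φ₂, S) →
      Sim P (.loop e c) pc (Φ, S) (resolve P l) (Φ₁, S)
  | lockAcq (pc Φ S lab k) : P[pc]? = some (lab, .lockAcq k) →
      Sim P (.lockAcq k) pc (Φ, S) (pc + 1) (Φ, S.acq D k)
  | lockRel (pc Φ S lab k) : P[pc]? = some (lab, .lockRel k) →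
      Sim P (.lockRel k) pc (Φ, S) (pc + 1)
        (Φ.purge {v | ¬ VarStable D (S.rel D k) v}, S.rel D k)
  | jmp (c pc C pc₁ C₁ lab l) : Sim P c pc C pc₁ C₁ → P[pc₁]? = some (lab, .jmp l) →
      Sim P c pc C (resolve P l) C₁
  | nop (c pc C pc₁ C₁ lab) : Sim P c pc C pc₁ C₁ → P[pc₁]? = some (lab, .nop) →
      Sim P c pc C (pc₁ + 1) C₁
  | weaken (c pc C pc₁ C₁ C₂) : Sim P c pc C pc₁ C₁ → CompRec.Le C₂ C₁ → Sim P c pc C pc₁ C₂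

/-! ### Correctness of compilation records and its preservation. -/

/-- The compilation record is correct for the given modes, memory and registers. -/
structure RecOK (C : CompRec X V R) (mds : ModeState (Shared L X)) (mem : Mem L X V)
    (regs : R → V) : Prop where
  eval : ∀ r e, C.1 r = some e → regs r = e.eval mem
  stable : RegRecStable D C
  noW : ∀ v, v ∈ C.2.1 ↔ Shared.var v ∈ mds Mode.asmNoW
  noRW : ∀ v, v ∈ C.2.2 ↔ Shared.var v ∈ mds Mode.asmNoRW

theorem Expr.eval_congr {m m' : Mem L X V} (e : Expr X V)
    (h : ∀ v ∈ e.vars, m (Shared.var v) = m' (Shared.var v)) : e.eval m = e.eval m' := by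
  induction e with
  | const n => rfl
  | var v => exact h v rfl
  | op f e₁ e₂ ih₁ ih₂ =>
    simp only [Expr.eval]
    rw [ih₁ fun v hv => h v (Or.inl hv), ih₂ fun v hv => h v (Or.inr hv)]

theorem purge_eq_some {Φ : RegRec X V R} {U : Set X} {r : R} {e : Expr X V}
    (h : Φ.purge U r = some e) : Φ r = some e ∧ ∀ v ∈ e.vars, v ∉ U := by
  simp only [RegRec.purge, Option.bind_eq_some_iff] at h
  obtain ⟨e', he', h⟩ := h
  split_ifs at h with hU
  cases h
  exact ⟨he', fun v hv hvU => hU ⟨v, hv, hvU⟩⟩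

theorem RegRec.meet_le {Φ Φ' : RegRec X V R} {r : R} {e : Expr X V} (h : Φ.meet Φ' r = some e) :
    Φ r = some e ∧ Φ' r = some e := by
  simp only [RegRec.meet] at h
  split_ifs at h with h'
  exact ⟨h, h' ▸ h⟩

variable {D}

theorem RecOK.le {C C' : CompRec X V R} {mds : ModeState (Shared L X)} {mem : Mem L X V}
    {regs : R → V} (h : RecOK D C mds mem regs) (hle : CompRec.Le C' C) :
    RecOK D C' mds mem regs where
  eval r e he := h.eval r e (hle.2 r e he)
  stable r e he := by rw [hle.1]; exact h.stable r e (hle.2 r e he)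
  noW := by rw [hle.1]; exact h.noW
  noRW := by rw [hle.1]; exact h.noRW

/-- Changes to writable variables do not invalidate compilation records. -/
theorem RecOK.of_writable {C : CompRec X V R} {mds : ModeState (Shared L X)} {mem mem' : Mem L X V}
    {regs : R → V} (h : RecOK D C mds mem regs) (hw : ∀ x, mem x ≠ mem' x → Writable mds x) :
    RecOK D C mds mem' regs where
  eval r e he := by
    rw [h.eval r e he]
    refine Expr.eval_congr e fun v hv => ?_
    by_contra hne
    obtain ⟨h₁, h₂⟩ := hw _ hne
    rcases (h.stable r e he v hv).1 with hS | hS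
    · exact h₁ ((h.noW v).1 hS)
    · exact h₂ ((h.noRW v).1 hS)
  stable := h.stable
  noW := h.noW
  noRW := h.noRW

open Classical in
theorem RecOK.update {Φ : RegRec X V R} {S : AsmRec X} {mds : ModeState (Shared L X)}
    {mem : Mem L X V} {regs : R → V} (h : RecOK D (Φ, S) mds mem regs) (r : R) (e : Expr X V)
    (he : ∀ v ∈ e.vars, VarStable D S v) :
    RecOK D (Function.update Φ r (some e), S) mds mem
      (Function.update regs r (e.eval mem)) where
  eval r' e' he' := by
    by_cases hr : r' = r
    · subst hr; simp at he'; simp [he']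
    · simp only [Function.update_of_ne hr] at he' ⊢; exact h.eval r' e' he'
  stable r' e' he' := by
    by_cases hr : r' = r
    · subst hr; simp at he'; subst he'; exact he
    · simp only [Function.update_of_ne hr] at he'; exact h.stable r' e' he'
  noW := h.noW
  noRW := h.noRW

open Classical in
theorem RecOK.store {Φ : RegRec X V R} {S : AsmRec X} {mds : ModeState (Shared L X)}
    {mem : Mem L X V} {regs : R → V} (h : RecOK D (Φ, S) mds mem regs) (v : X) (a : V) :
    RecOK D (Φ.purge {v}, S) mds (Function.update mem (Shared.var v) a) regs where
  eval r e he := by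
    obtain ⟨he, hv⟩ := purge_eq_some he
    rw [h.eval r e he]
    refine Expr.eval_congr e fun w hw => ?_
    rw [Function.update_of_ne]
    rintro ⟨⟩
    exact hv _ hw rfl
  stable r e he := h.stable r e (purge_eq_some he).1
  noW := h.noW
  noRW := h.noRW

-- Assumptions only grow, so stable variables stay stable, and no expression mentions a lock
-- variable.
open Classical in
theorem RecOK.lockAcq {Φ : RegRec X V R} {S : AsmRec X} {mds : ModeState (Shared L X)}
    {mem : Mem L X V} {regs : R → V} (h : RecOK D (Φ, S) mds mem regs) (k : L) (a : V) :
    RecOK D (Φ, S.acq D k) (lockAcqUpd D mds k)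
      (Function.update mem (Shared.lock k) a) regs where
  eval r e he := by
    rw [h.eval r e he]
    exact Expr.eval_congr e fun w _ => by rw [Function.update_of_ne]; rintro ⟨⟩
  stable r e he v hv := by
    obtain ⟨h₁, h₂⟩ := h.stable r e he v hv
    have hsub : S.1 ∪ S.2 ⊆ (S.acq D k).1 ∪ (S.acq D k).2 :=
      Set.union_subset_union Set.subset_union_left Set.subset_union_left
    exact ⟨hsub h₁, fun w hw => hsub (h₂ w hw)⟩
  noW v := by
    have := h.noW v
    simp_all [AsmRec.acq, lockAcqUpd]
  noRW v := by
    have := h.noRW v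
    simp_all [AsmRec.acq, lockAcqUpd]

-- Dropping assumptions can destabilise variables; the purge removes exactly the entries that
-- mention one.
open Classical in
theorem RecOK.lockRel {Φ : RegRec X V R} {S : AsmRec X} {mds : ModeState (Shared L X)}
    {mem : Mem L X V} {regs : R → V} (h : RecOK D (Φ, S) mds mem regs) (k : L) (a : V) :
    RecOK D (Φ.purge {v | ¬ VarStable D (S.rel D k) v}, S.rel D k) (lockRelUpd D mds k)
      (Function.update mem (Shared.lock k) a) regs where
  eval r e he := by
    rw [h.eval r e (purge_eq_some he).1]
    exact Expr.eval_congr e fun w _ => by rw [Function.update_of_ne]; rintro ⟨⟩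
  stable r e he v hv := not_not.1 ((purge_eq_some he).2 v hv)
  noW v := by
    have := h.noW v
    simp_all [AsmRec.rel, lockRelUpd]
  noRW v := by
    have := h.noRW v
    simp_all [AsmRec.rel, lockRelUpd]

/-! ### Pairs of source runs and matching of RISC steps. -/

/-- A family of pairs of memories, indexed by commands and mode states, in which the steps of the
first component are matched by the second, and which agrees on guards about to be evaluated. -/
structure Lockstep [Zero V] (D : Discipline L X V)
    (W : Cmd L X V → ModeState (Shared L X) → Mem L X V → Mem L X V → Prop) : Prop where
  step : ∀ c mds m₁ m₂ c' mds' m₁', W c mds m₁ m₂ → WhileStep D ⟨c, mds, m₁⟩ ⟨c', mds', m₁'⟩ →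
    ∃ m₂', WhileStep D ⟨c, mds, m₂⟩ ⟨c', mds', m₂'⟩ ∧ W c' mds' m₁' m₂'
  guard : ∀ c mds m₁ m₂ e c₁ c₂, W c mds m₁ m₂ → c.leftmost = .ite e c₁ c₂ →
    e.eval m₁ = e.eval m₂

theorem Cmd.seq_ne_right (c₁ c₂ : Cmd L X V) : Cmd.seq c₁ c₂ ≠ c₂ := by
  intro h
  have := congrArg sizeOf h
  simp at this

/-- Appending a fixed continuation preserves the lockstep property. This is what lets an induction
over `Sim`, with the family generalised, treat the first half of a sequence on its own. -/
theorem Lockstep.seq [Zero V]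
    {W : Cmd L X V → ModeState (Shared L X) → Mem L X V → Mem L X V → Prop}
    (hW : Lockstep D W) (c₂ : Cmd L X V) : Lockstep D fun c => W (.seq c c₂) where
  step c mds m₁ m₂ c' mds' m₁' h hs := by
    obtain ⟨m₂', hs', h'⟩ := hW.step _ _ _ _ _ _ _ h (.seq _ _ c₂ _ _ _ _ hs)
    refine ⟨m₂', ?_, h'⟩
    generalize hq : Cmd.seq c' c₂ = q at hs'
    cases hs' with
    | seq _ _ _ _ _ _ _ hs' => cases hq; exact hs'
    | seqHalt => exact absurd hq (Cmd.seq_ne_right _ _)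
  guard c mds m₁ m₂ e c₁ c₃ h hl := hW.guard _ _ _ _ e c₁ c₃ h hl

/-- The outcome of a pair of matching steps from a pair of RISC configurations that share the
program counter, the program text and the mode state. -/
def Matched [Zero V] (D : Discipline L X V) (P : List (Instr L X V R))
    (W : Cmd L X V → ModeState (Shared L X) → Mem L X V → Mem L X V → Prop)
    (pc : ℕ) (mds : ModeState (Shared L X)) (m₁ m₂ : Mem L X V) (regs₁ regs₂ : R → V)
    (pc' : ℕ) (C' : CompRec X V R) : Prop :=
  ∀ lc, RiscStep D ⟨((pc, P), regs₁), mds, m₁⟩ lc →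
    ∃ c p C mds' m₁' m₂' regs₁' regs₂', lc = ⟨((p, P), regs₁'), mds', m₁'⟩ ∧
      RiscStep D ⟨((pc, P), regs₂), mds, m₂⟩ ⟨((p, P), regs₂'), mds', m₂'⟩ ∧
      Sim D P c p C pc' C' ∧ RecOK D C mds' m₁' regs₁' ∧ RecOK D C mds' m₂' regs₂' ∧
      W c mds' m₁' m₂'

section Steps

variable [Zero V] {P : List (Instr L X V R)}
  {W : Cmd L X V → ModeState (Shared L X) → Mem L X V → Mem L X V → Prop}
  {pc : ℕ} {mds : ModeState (Shared L X)} {m₁ m₂ : Mem L X V} {regs₁ regs₂ : R → V}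

/-- Straight-line code is either exhausted or makes a step that leaves memory and modes alone. -/
theorem Straight.matched {S : AsmRec X} {Φ Φ₁ : RegRec X V R} {pc₁ : ℕ}
    (h : Straight D P S pc Φ pc₁ Φ₁)
    (h₁ : RecOK D (Φ, S) mds m₁ regs₁) (h₂ : RecOK D (Φ, S) mds m₂ regs₂)
    {c : Cmd L X V} (hw : W c mds m₁ m₂) {pc' : ℕ} {C' : CompRec X V R}
    (hc : ∀ pc Φ, Straight D P S pc Φ pc₁ Φ₁ → Sim D P c pc (Φ, S) pc' C') :
    (pc = pc₁ ∧ Φ = Φ₁) ∨ Matched D P W pc mds m₁ m₂ regs₁ regs₂ pc' C' := by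
  cases h with
  | refl => exact Or.inl ⟨rfl, rfl⟩
  | load _ _ lab r v _ _ hi hv hrest =>
    refine Or.inr fun lc hs => ?_
    cases hs with
    | load _ _ _ _ _ _ _ _ hi' =>
      obtain ⟨⟩ := hi.symm.trans hi'
      have hv' : ∀ w ∈ (Expr.var v : Expr X V).vars, VarStable D S w := by rintro _ ⟨⟩; exact hv
      exact ⟨c, _, _, _, _, _, _, _, rfl, .load _ _ _ _ _ _ _ _ hi, hc _ _ hrest,
        h₁.update r _ hv', h₂.update r _ hv', hw⟩
    | _ => simp_all
  | moveK _ _ lab r n _ _ hi hrest =>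
    refine Or.inr fun lc hs => ?_
    cases hs with
    | moveK _ _ _ _ _ _ _ _ hi' =>
      obtain ⟨⟩ := hi.symm.trans hi'
      have hv' : ∀ w ∈ (Expr.const n : Expr X V).vars, VarStable D S w := by rintro _ ⟨⟩
      exact ⟨c, _, _, _, _, _, _, _, rfl, .moveK _ _ _ _ _ _ _ _ hi, hc _ _ hrest,
        h₁.update r _ hv', h₂.update r _ hv', hw⟩
    | _ => simp_all
  | op _ _ lab f r r' e e' _ _ hi hr hr' hrest =>
    refine Or.inr fun lc hs => ?_
    cases hs with
    | op _ _ _ _ _ _ _ _ _ hi' =>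
      obtain ⟨⟩ := hi.symm.trans hi'
      have hv' : ∀ w ∈ (Expr.op f e e').vars, VarStable D S w := by
        rintro w (hw' | hw')
        · exact h₁.stable r e hr w hw'
        · exact h₁.stable r' e' hr' w hw'
      have h₁' := h₁.update r _ hv'
      have h₂' := h₂.update r _ hv'
      simp only [Expr.eval] at h₁' h₂'
      rw [← h₁.eval r e hr, ← h₁.eval r' e' hr'] at h₁'
      rw [← h₂.eval r e hr, ← h₂.eval r' e' hr'] at h₂'
      exact ⟨c, _, _, _, _, _, _, _, rfl, .op _ _ _ _ _ _ _ _ _ hi, hc _ _ hrest, h₁', h₂', hw⟩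
    | _ => simp_all

/-- Stated apart from `Sim.matched` because a loop, once unfolded, is handled by the same argument.
-/
theorem matched_ite (hW : Lockstep D W) {e : Expr X V} {c₁ c₂ : Cmd L X V} {S : AsmRec X}
    {Φ Φ₁ : RegRec X V R} {pc₁ pc' l : ℕ} {lab : Option ℕ} {r : R} {C' : CompRec X V R}
    (hst : Straight D P S pc Φ pc₁ Φ₁) (hi : P[pc₁]? = some (lab, .jz l r)) (hr : Φ₁ r = some e)
    (hs₁ : Sim D P c₁ (pc₁ + 1) (Φ₁, S) pc' C') (hs₂ : Sim D P c₂ (resolve P l) (Φ₁, S) pc' C')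
    (hw : W (.ite e c₁ c₂) mds m₁ m₂)
    (h₁ : RecOK D (Φ, S) mds m₁ regs₁) (h₂ : RecOK D (Φ, S) mds m₂ regs₂) :
    Matched D P W pc mds m₁ m₂ regs₁ regs₂ pc' C' := by
  rcases hst.matched h₁ h₂ hw fun p Ψ h => .ite e c₁ c₂ p Ψ S _ _ _ l r _ _ h hi hr hs₁ hs₂ with
    ⟨rfl, rfl⟩ | h
  · intro lc hs
    have hg := hW.guard _ _ _ _ e c₁ c₂ hw rfl
    have e₁ := h₁.eval r e hr
    have e₂ := h₂.eval r e hr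
    cases hs with
    | jzTrue _ _ _ _ _ _ _ _ hi' hz =>
      obtain ⟨⟩ := hi.symm.trans hi'
      obtain ⟨m₂', hs', hw'⟩ := hW.step _ _ _ _ _ _ _ hw (.iteFalse e c₁ c₂ mds m₁ (e₁ ▸ hz))
      -- If the branches coincide either rule may have fired, but neither touches memory.
      have hm : m₂' = m₂ := by cases hs' <;> rfl
      subst hm
      exact ⟨c₂, _, _, _, _, _, _, _, rfl,
        .jzTrue _ _ _ _ _ _ _ _ hi (by rw [e₂, ← hg, ← e₁]; exact hz), hs₂, h₁, h₂, hw'⟩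
    | jzFalse _ _ _ _ _ _ _ _ hi' hz =>
      obtain ⟨⟩ := hi.symm.trans hi'
      obtain ⟨m₂', hs', hw'⟩ := hW.step _ _ _ _ _ _ _ hw (.iteTrue e c₁ c₂ mds m₁ (e₁ ▸ hz))
      have hm : m₂' = m₂ := by cases hs' <;> rfl
      subst hm
      exact ⟨c₁, _, _, _, _, _, _, _, rfl,
        .jzFalse _ _ _ _ _ _ _ _ hi (by rw [e₂, ← hg, ← e₁]; exact hz), hs₁, h₁, h₂, hw'⟩
    | _ => simp_all
  · exact h

/-- Used to put a continuation or trailing code back around a step made inside a subcommand. -/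
theorem Matched.imp {W' : Cmd L X V → ModeState (Shared L X) → Mem L X V → Mem L X V → Prop}
    {pc₁ pc₂ : ℕ} {C₁ C₂ : CompRec X V R} (g : Cmd L X V → Cmd L X V)
    (h : Matched D P W' pc mds m₁ m₂ regs₁ regs₂ pc₁ C₁)
    (hw : ∀ c mds m₁ m₂, W' c mds m₁ m₂ → W (g c) mds m₁ m₂)
    (hs : ∀ c p C, Sim D P c p C pc₁ C₁ → Sim D P (g c) p C pc₂ C₂) :
    Matched D P W pc mds m₁ m₂ regs₁ regs₂ pc₂ C₂ := by
  intro lc hlc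
  obtain ⟨c, p, C, mds', m₁', m₂', r₁, r₂, h₁, h₂, h₃, h₄, h₅, h₆⟩ := h lc hlc
  exact ⟨g c, p, C, mds', m₁', m₂', r₁, r₂, h₁, h₂, hs _ _ _ h₃, h₄, h₅, hw _ _ _ _ h₆⟩

/-- A pair of simulated runs either has finished the command or makes matching steps. -/
theorem Sim.matched {c : Cmd L X V} {C C' : CompRec X V R} {pc' : ℕ}
    (h : Sim D P c pc C pc' C') (hW : Lockstep D W) (hw : W c mds m₁ m₂)
    (h₁ : RecOK D C mds m₁ regs₁) (h₂ : RecOK D C mds m₂ regs₂) :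
    (pc = pc' ∧ CompRec.Le C' C ∧ W .halt mds m₁ m₂) ∨
      Matched D P W pc mds m₁ m₂ regs₁ regs₂ pc' C' := by
  induction h generalizing W with
  | halt => exact Or.inl ⟨rfl, ⟨rfl, fun _ _ h => h⟩, hw⟩
  | skip pc C lab hi =>
    refine Or.inr fun lc hs => ?_
    cases hs with
    | nop _ _ _ _ _ _ hi' =>
      obtain ⟨m₂', hs', hw'⟩ := hW.step _ _ _ _ _ _ _ hw (.skip mds m₁)
      cases hs'
      exact ⟨.halt, _, _, _, _, _, _, _, rfl, .nop _ _ _ _ _ _ hi, .halt _ _, h₁, h₂, hw'⟩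
    | _ => simp_all
  | assign pc Φ S pc₁ Φ₁ lab v e r hst hi hr =>
    rcases hst.matched h₁ h₂ hw fun p Ψ h => .assign p Ψ S _ _ _ v e r h hi hr with
      ⟨rfl, rfl⟩ | h
    · refine Or.inr fun lc hs => ?_
      have e₁ := h₁.eval r e hr
      have e₂ := h₂.eval r e hr
      cases hs with
      | store _ _ _ _ _ _ _ _ hi' =>
        obtain ⟨⟩ := hi.symm.trans hi'
        obtain ⟨m₂', hs', hw'⟩ := hW.step _ _ _ _ _ _ _ hw (.assign v e mds m₁)
        cases hs'
        rw [← e₁, ← e₂] at hw'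
        exact ⟨.halt, _, _, _, _, _, _, _, rfl, .store _ _ _ _ _ _ _ _ hi, .halt _ _,
          h₁.store v _, h₂.store v _, hw'⟩
      | _ => simp_all
    · exact Or.inr h
  | seq c₁ c₂ pc C pc₁ C₁ pc₂ C₂ hs₁ hs₂ ih₁ ih₂ =>
    rcases ih₁ (hW.seq c₂) hw h₁ h₂ with ⟨rfl, hle, hw'⟩ | h
    -- A silent While step: the code has no instruction between the two components.
    · obtain ⟨m₂', hs', hw''⟩ := hW.step _ _ _ _ _ _ _ hw' (.seqHalt c₂ mds m₁)
      have hm : m₂' = m₂ := by cases hs'; rfl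
      subst hm
      rcases ih₂ hW hw'' (h₁.le hle) (h₂.le hle) with ⟨rfl, hle', hw₃⟩ | h
      · exact Or.inl ⟨rfl, ⟨hle'.1.trans hle.1, fun r e h => hle.2 r e (hle'.2 r e h)⟩, hw₃⟩
      · exact Or.inr h
    · exact Or.inr (h.imp (Cmd.seq · c₂) (fun _ _ _ _ h => h)
        fun c p C h => .seq _ _ _ _ _ _ _ _ h hs₂)
  | ite e c₁ c₂ pc Φ S pc₁ Φ₁ lab l r pc' C' hst hi hr hs₁ hs₂ =>
    exact Or.inr (matched_ite hW hst hi hr hs₁ hs₂ hw h₁ h₂)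
  | loop e c pc Φ S pc₁ Φ₁ lab l r Φ₂ hst hi hr hs ih =>
    -- The loop is unfolded silently, since agreement on the guard is only available for a
    -- conditional.
    obtain ⟨m₂', hs', hw'⟩ := hW.step _ _ _ _ _ _ _ hw (.loop e c mds m₁)
    cases hs'
    have hle : CompRec.Le ((fun _ => none, S) : CompRec X V R) (Φ, S) :=
      ⟨rfl, fun _ _ h => nomatch h⟩
    -- The body ends at `pc`, where the loop is simulated again. Its final register record `Φ₂` is
    -- immaterial because the guard is compiled from an empty record.
    exact Or.inr (matched_ite hW hst hi hr
      (.seq _ _ _ _ _ _ _ _ hs (.loop e c pc Φ₂ S _ _ _ l r _ hst hi hr hs)) (.halt _ _) hw'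
      (h₁.le hle) (h₂.le hle))
  | lockAcq pc Φ S lab k hi =>
    refine Or.inr fun lc hs => ?_
    cases hs with
    | lockAcq _ _ _ _ _ _ _ hi' hk =>
      obtain ⟨⟩ := hi.symm.trans hi'
      obtain ⟨m₂', hs', hw'⟩ := hW.step _ _ _ _ _ _ _ hw (.lockAcq k mds m₁ hk)
      generalize hq : lockAcqUpd D mds k = q at hs'
      cases hs' with
      | lockAcq _ _ _ hk₂ =>
        exact ⟨.halt, _, _, _, _, _, _, _, rfl, .lockAcq _ _ _ _ _ _ _ hi hk₂, .halt _ _,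
          h₁.lockAcq k _, h₂.lockAcq k _, hw'⟩
    | lockSpin _ _ _ _ _ _ _ hi' hk =>
      obtain ⟨⟩ := hi.symm.trans hi'
      obtain ⟨m₂', hs', hw'⟩ := hW.step _ _ _ _ _ _ _ hw (.lockSpin k mds m₁ hk)
      cases hs' with
      | lockSpin _ _ _ hk₂ =>
        exact ⟨.lockAcq k, _, _, _, _, _, _, _, rfl, .lockSpin _ _ _ _ _ _ _ hi hk₂,
          .lockAcq _ _ _ _ _ hi, h₁, h₂, hw'⟩
    | _ => simp_all
  | lockRel pc Φ S lab k hi =>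
    refine Or.inr fun lc hs => ?_
    cases hs with
    | lockRel _ _ _ _ _ _ _ hi' hk =>
      obtain ⟨⟩ := hi.symm.trans hi'
      obtain ⟨m₂', hs', hw'⟩ := hW.step _ _ _ _ _ _ _ hw (.lockRel k mds m₁ hk)
      generalize hq : lockRelUpd D mds k = q at hs'
      cases hs' with
      | lockRel _ _ _ hk₂ =>
        exact ⟨.halt, _, _, _, _, _, _, _, rfl, .lockRel _ _ _ _ _ _ _ hi hk₂, .halt _ _,
          h₁.lockRel k _, h₂.lockRel k _, hw'⟩
    | lockInvalid _ _ _ _ _ _ _ hi' hk =>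
      obtain ⟨⟩ := hi.symm.trans hi'
      -- Validity of a release depends on the modes alone, so the second run is stuck as well and
      -- the pair does not change.
      exact ⟨.lockRel k, _, _, _, _, _, _, _, rfl, .lockInvalid _ _ _ _ _ _ _ hi hk,
        .lockRel _ _ _ _ _ hi, h₁, h₂, hw⟩
    | _ => simp_all
  | jmp c pc C pc₁ C₁ lab l hs hi ih =>
    rcases ih hW hw h₁ h₂ with ⟨rfl, hle, hw'⟩ | h
    · refine Or.inr fun lc hs => ?_
      cases hs with
      | jmp _ _ _ _ _ _ _ hi' =>
        obtain ⟨⟩ := hi.symm.trans hi'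
        -- The jump has no While counterpart; the residual command is already terminated and stays
        -- so.
        exact ⟨.halt, _, _, _, _, _, _, _, rfl, .jmp _ _ _ _ _ _ _ hi, .halt _ _,
          h₁.le hle, h₂.le hle, hw'⟩
      | _ => simp_all
    · exact Or.inr (h.imp id (fun _ _ _ _ h => h) fun c p C h => .jmp _ _ _ _ _ _ _ h hi)
  | nop c pc C pc₁ C₁ lab hs hi ih =>
    rcases ih hW hw h₁ h₂ with ⟨rfl, hle, hw'⟩ | h
    · refine Or.inr fun lc hs => ?_
      cases hs with
      | nop _ _ _ _ _ _ hi' =>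
        exact ⟨.halt, _, _, _, _, _, _, _, rfl, .nop _ _ _ _ _ _ hi, .halt _ _,
          h₁.le hle, h₂.le hle, hw'⟩
      | _ => simp_all
    · exact Or.inr (h.imp id (fun _ _ _ _ h => h) fun c p C h => .nop _ _ _ _ _ _ h hi)
  | weaken c pc C pc₁ C₁ C₂ hs hle ih =>
    rcases ih hW hw h₁ h₂ with ⟨rfl, hle', hw'⟩ | h
    · exact Or.inl ⟨rfl, ⟨hle.1.trans hle'.1, fun r e h => hle'.2 r e (hle.2 r e h)⟩, hw'⟩
    · exact Or.inr (h.imp id (fun _ _ _ _ h => h) fun c p C h => .weaken _ _ _ _ _ _ h hle)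

end Steps

/-! ### Transfer of security from source to target. -/

/-- A program text that executes a secure command is secure. -/
theorem comSecure_of_sim [Zero V] {P : List (Instr L X V R)} {c : Cmd L X V} {regs : R → V}
    {C C' : CompRec X V R} {mds : ModeState (Shared L X)} {INIT : Mem L X V → Prop}
    (h : ComSecure D.cl (WhileStep D) INIT NoHighBranching c mds)
    (hs : Sim D P c 0 C P.length C') (hC : ∀ mem, RecOK D C mds mem regs) :
    ComSecure D.cl (RiscStep D) INIT PCSecurity ((0, P), regs) mds := by
  intro mem₁ mem₂ hmem
  obtain ⟨B, ⟨hcg, hsymm, hstep⟩, hnhb, hB⟩ := h mem₁ mem₂ hmem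
  have hW : Lockstep D fun c mds m₁ m₂ => B ⟨c, mds, m₁⟩ ⟨c, mds, m₂⟩ := by
    constructor
    · intro c mds m₁ m₂ c' mds' m₁' hw hs
      obtain ⟨⟨c₂, mds₂, m₂'⟩, hs', rfl, hB'⟩ := (hstep _ _ hw rfl).2 _ hs
      -- Ruling out high branching at the successor pair forces both runs to reach the same command.
      obtain ⟨rfl, -⟩ := hnhb _ _ _ _ _ hB'
      exact ⟨m₂', hs', hB'⟩
    · intro c mds m₁ m₂ e c₁ c₂ hw hl
      exact (hnhb _ _ _ _ _ hw).2 e c₁ c₂ hl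
  refine ⟨fun lc₁ lc₂ => ∃ c pc C mds m₁ m₂ regs₁ regs₂, lc₁ = ⟨((pc, P), regs₁), mds, m₁⟩ ∧
    lc₂ = ⟨((pc, P), regs₂), mds, m₂⟩ ∧ Sim D P c pc C P.length C' ∧ RecOK D C mds m₁ regs₁ ∧
    RecOK D C mds m₂ regs₂ ∧ B ⟨c, mds, m₁⟩ ⟨c, mds, m₂⟩, ⟨?_, ?_, ?_⟩, ?_, ?_⟩
  · rintro _ _ _ _ _ ⟨c, pc, C, mds, m₁, m₂, regs₁, regs₂, ⟨⟩, ⟨⟩, hs, h₁, h₂, hB⟩ m₁' m₂' hch hle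
    exact ⟨c, pc, C, _, m₁', m₂', regs₁, regs₂, rfl, rfl, hs,
      h₁.of_writable fun x hx => hch x (Or.inl hx),
      h₂.of_writable fun x hx => hch x (Or.inr (Or.inl hx)), hcg _ _ _ _ _ hB _ _ hch hle⟩
  · rintro _ _ ⟨c, pc, C, mds, m₁, m₂, regs₁, regs₂, rfl, rfl, hs, h₁, h₂, hB⟩
    exact ⟨c, pc, C, mds, m₂, m₁, regs₂, regs₁, rfl, rfl, hs, h₂, h₁, hsymm _ _ hB⟩
  · rintro _ _ ⟨c, pc, C, mds, m₁, m₂, regs₁, regs₂, rfl, rfl, hs, h₁, h₂, hB⟩ -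
    refine ⟨(hstep _ _ hB rfl).1, fun lc hlc => ?_⟩
    rcases hs.matched hW hB h₁ h₂ with ⟨rfl, -, -⟩ | h
    -- Here the program counter is at the end of the text, where no RISC step exists.
    · cases hlc <;> simp_all
    · obtain ⟨c, p, C, mds', m₁', m₂', r₁, r₂, rfl, h₂, h₃, h₄, h₅, h₆⟩ := h lc hlc
      exact ⟨_, h₂, rfl, c, p, C, mds', m₁', m₂', r₁, r₂, rfl, rfl, h₃, h₄, h₅, h₆⟩
  · rintro _ _ _ _ _ _ _ _ _ ⟨c, pc, C, mds, m₁, m₂, regs₁, regs₂, ⟨⟩, ⟨⟩, -⟩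
    exact ⟨rfl, rfl⟩
  · exact ⟨c, 0, C, mds, mem₁, mem₂, regs, regs, rfl, rfl, hs, hC _, hC _, hB⟩

end Simulation


/-! ## Correctness of the compiler -/

section CompilerCorrectness

variable {L X V R : Type*}

/-! ### Label resolution and the labels of expression code. -/

theorem resolve_append {P Q : List (Instr L X V R)} {x : ℕ} (h : ∀ i ∈ P, i.1 ≠ some x) :
    resolve (P ++ Q) x = P.length + resolve Q x := by
  simp only [resolve]
  induction P with
  | nil => simp
  | cons i P ih =>
    have hi : (i.1 == some x) = false := by simpa using h i (by simp)
    rw [List.cons_append, List.findIdx_cons, hi, ih fun j hj => h j (by simp [hj])]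
    simp
    omega

/-- The first instruction carries the label `l`, and the others carry none. -/
def LabelledBy (l : Option ℕ) (Q : CompText L X V R) : Prop :=
  ∃ i t, Q = i :: t ∧ i.1.1 = l ∧ ∀ j ∈ t, j.1.1 = none

theorem LabelledBy.append {l : Option ℕ} {Q Q' : CompText L X V R} (h : LabelledBy l Q)
    (h' : ∀ j ∈ Q', j.1.1 = none) : LabelledBy l (Q ++ Q') := by
  obtain ⟨i, t, rfl, hi, ht⟩ := h
  refine ⟨i, t ++ Q', rfl, hi, fun j hj => ?_⟩
  rcases List.mem_append.1 hj with hj | hj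
  · exact ht j hj
  · exact h' j hj

theorem LabelledBy.of_none {Q : CompText L X V R} (h : Q = [] ∨ LabelledBy none Q) :
    ∀ j ∈ Q, j.1.1 = none := by
  rcases h with rfl | ⟨i, t, rfl, hi, ht⟩
  · simp
  · intro j hj
    rcases List.mem_cons.1 hj with rfl | hj
    · exact hi
    · exact ht j hj

theorem LabelledBy.snoc {l : Option ℕ} {Q : CompText L X V R} (h : Q = [] ∨ LabelledBy l Q)
    (b : InstrBody L X V R) (C : CompRec X V R) :
    LabelledBy l (Q ++ [((if Q.isEmpty then l else none, b), C)]) := by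
  rcases h with rfl | h
  · exact ⟨_, [], rfl, rfl, by simp⟩
  · refine h.append ?_
    obtain ⟨i, t, rfl, hi, ht⟩ := h
    simp

theorem compileExpr_labels {ra : RegAlloc X V R} {e : Expr X V} {C C' : CompRec X V R} {A : Set R}
    {l : Option ℕ} {Pe : CompText L X V R} {r : R}
    (h : compileExpr ra C A l e = some (Pe, r, C')) : Pe = [] ∨ LabelledBy l Pe := by
  induction e generalizing C C' A l Pe r with
  | const n =>
    rw [compileExpr] at h
    split at h <;> cases h
    exact Or.inr ⟨_, [], rfl, rfl, by simp⟩
  | var v =>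
    rw [compileExpr] at h
    split at h
    · cases h; exact Or.inl rfl
    · split at h <;> cases h
      exact Or.inr ⟨_, [], rfl, rfl, by simp⟩
  | op f e₁ e₂ ih₁ ih₂ =>
    rw [compileExpr] at h
    split at h
    · cases h
    rename_i P₁ r₁ C₁ h₁
    split at h
    · cases h
    rename_i P₂ r₂ C₂ h₂
    cases h
    refine Or.inr (LabelledBy.snoc ?_ _ _)
    have h₂ := ih₂ h₂
    rcases ih₁ h₁ with rfl | h₁
    · simpa using h₂
    · refine Or.inr (h₁.append ?_)
      obtain ⟨i, t, rfl, hi, ht⟩ := h₁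
      exact LabelledBy.of_none (by simpa using h₂)

/-- With no register recorded, `allocCached` cannot succeed, so even a variable costs a load. Hence
the head label of a loop does land on an instruction of its guard. -/
theorem compileExpr_ne_nil {ra : RegAlloc X V R} {e : Expr X V} {S : AsmRec X} {C' : CompRec X V R}
    {A : Set R} {l : Option ℕ} {Pe : CompText L X V R} {r : R}
    (h : compileExpr ra (fun _ => none, S) A l e = some (Pe, r, C')) : Pe ≠ [] := by
  cases e with
  | const n =>
    rw [compileExpr] at h
    split at h <;> cases h
    simp
  | var v =>
    rw [compileExpr] at h
    split at h
    · rename_i r hr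
      exact nomatch (ra.allocCached_spec _ _ _ _ hr).2
    · split at h <;> cases h
      simp
  | op f e₁ e₂ =>
    rw [compileExpr] at h
    split at h
    · cases h
    split at h
    · cases h
    cases h
    simp

/-! ### Correctness of expression code. -/

theorem getElem?_of_split {P Q₁ Q₂ : List (Instr L X V R)} {i : Instr L X V R} {n : ℕ}
    (hP : P = Q₁ ++ i :: Q₂) (hn : Q₁.length = n) : P[n]? = some i := by
  subst hn hP; simp

-- The clauses about `A` carry the induction for binary operators: the second operand is compiled
-- with the first result register added to the registers in use, so the first result survives until
-- it is combined.
open Classical in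
theorem compileExpr_straight (D : Discipline L X V) {ra : RegAlloc X V R} {e : Expr X V}
    {C C' : CompRec X V R} {A : Set R} {l : Option ℕ} {Pe : CompText L X V R} {r : R}
    (h : compileExpr ra C A l e = some (Pe, r, C')) (he : ∀ v ∈ e.vars, VarStable D C.2 v)
    {P pre post : List (Instr L X V R)} (hP : P = pre ++ Pe.map Prod.fst ++ post) {pc pc' : ℕ}
    (hpc : pre.length = pc) (hpc' : pc + Pe.length = pc') :
    Straight D P C.2 pc C.1 pc' C'.1 ∧
      C'.2 = C.2 ∧ C'.1 r = some e ∧ r ∉ A ∧ ∀ r' ∈ A, C'.1 r' = C.1 r' := by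
  induction e generalizing C C' A l Pe r pre post pc pc' with
  | const n =>
    rw [compileExpr] at h
    split at h <;> cases h
    rename_i hr
    have hA := ra.alloc_spec _ _ _ hr
    subst hpc'
    refine ⟨.moveK _ _ l r n _ _ (getElem?_of_split (by simpa using hP) hpc) (.refl _ _), rfl, by simp, hA, fun r' hr' => ?_⟩
    exact Function.update_of_ne (ne_of_mem_of_not_mem hr' hA) _ _
  | var v =>
    rw [compileExpr] at h
    split at h
    · rename_i hr
      cases h
      subst hpc'
      exact ⟨.refl _ _, rfl, (ra.allocCached_spec _ _ _ _ hr).2,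
        (ra.allocCached_spec _ _ _ _ hr).1, fun _ _ => rfl⟩
    · split at h <;> cases h
      rename_i hr
      have hA := ra.alloc_spec _ _ _ hr
      subst hpc'
      refine ⟨.load _ _ l r v _ _ (getElem?_of_split (by simpa using hP) hpc) (he v rfl) (.refl _ _), rfl, by simp, hA,
        fun r' hr' => ?_⟩
      exact Function.update_of_ne (ne_of_mem_of_not_mem hr' hA) _ _
  | op f e₁ e₂ ih₁ ih₂ =>
    rw [compileExpr] at h
    split at h
    · cases h
    rename_i P₁ r₁ C₁ h₁
    split at h
    · cases h
    rename_i P₂ r₂ C₂ h₂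
    cases h
    generalize hx : (((if (P₁ ++ P₂).isEmpty = true then l else none, InstrBody.op f r r₂), C₂) :
      Instr L X V R × CompRec X V R) = x at hP hpc'
    have hx' : x.1.2 = .op f r r₂ := by rw [← hx]
    obtain ⟨s₁, S₁, v₁, a₁, k₁⟩ := ih₁ h₁ (fun v hv => he v (Or.inl hv))
      (post := P₂.map Prod.fst ++ x.1 :: post) (by simpa using hP) hpc rfl
    obtain ⟨s₂, S₂, v₂, a₂, k₂⟩ := ih₂ h₂ (fun v hv => S₁ ▸ he v (Or.inr hv))
      (pre := pre ++ P₁.map Prod.fst) (post := x.1 :: post) (by simpa using hP)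
      (pc := pc + P₁.length) (by simp [hpc]) rfl
    rw [S₁] at s₂
    refine ⟨s₁.trans D (s₂.trans D (.op _ _ x.1.1 f r r₂ e₁ e₂ _ _ ?_ ?_ v₂ ?_)), ?_, by simp, a₁, ?_⟩
    · rw [← hx']
      exact getElem?_of_split (Q₁ := pre ++ P₁.map Prod.fst ++ P₂.map Prod.fst) (Q₂ := post)
        (by simpa using hP) (by simp [← hpc, add_assoc])
    · rw [k₂ _ (by simp), v₁]
    · obtain rfl : pc + P₁.length + P₂.length + 1 = pc' := by simpa [add_assoc] using hpc'
      exact .refl _ _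
    · exact S₂.trans S₁
    · intro r' hr'
      have hne : r' ≠ r := ne_of_mem_of_not_mem hr' a₁
      exact (Function.update_of_ne hne _ _).trans ((k₂ _ (Or.inl hr')).trans (k₁ _ hr'))

/-! ### Freshness of labels in command code. -/

/-- How labels are used in a text compiled with the label `l` and the unused label `nl`: the first
instruction carries `l`, all other labels are in the interval `[nl, nl')`, and the label required
of the following instruction is new. -/
structure LabelsOK (l : Option ℕ) (nl : ℕ) (Q : CompText L X V R) (l' : Option ℕ) (nl' : ℕ) :
    Prop where
  le : nl ≤ nl'
  head : ∃ i t, Q = i :: t ∧ ∀ x, l = some x → i.1.1 = some x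
  mem : ∀ i ∈ Q, ∀ x, i.1.1 = some x → l = some x ∨ (nl ≤ x ∧ x < nl')
  exit : ∀ x, l' = some x → nl ≤ x ∧ x < nl' ∧ ∀ i ∈ Q, i.1.1 ≠ some x

theorem LabelledBy.singleton (l : Option ℕ) (b : InstrBody L X V R) (C : CompRec X V R) :
    LabelledBy l [((l, b), C)] := ⟨_, [], rfl, rfl, by simp⟩

theorem LabelledBy.labelsOK {l : Option ℕ} {Q : CompText L X V R} (h : LabelledBy l Q) (nl : ℕ) :
    LabelsOK l nl Q none nl := by
  obtain ⟨i, t, rfl, hi, ht⟩ := h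
  refine ⟨le_rfl, ⟨i, t, rfl, fun _ h => hi.trans h⟩, fun j hj x hx => ?_, nofun⟩
  rcases List.mem_cons.1 hj with rfl | hj
  · exact Or.inl (hi.symm.trans hx)
  · rw [ht j hj] at hx; cases hx

/-- Inversion that turns the two computed labels into variables, keeping only how they relate to `l`
and `nl`. -/
theorem compileCore_loop {D : Discipline L X V} {ra : RegAlloc X V R} {e : Expr X V}
    {c : Cmd L X V} {C C' : CompRec X V R} {l l' : Option ℕ} {nl nl' : ℕ} {Q : CompText L X V R}
    (h : compileCore D ra C l nl (.loop e c) = some (Q, l', nl', C')) :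
    ∃ lp ex Pe r C₁ P₁ l₁ C₂,
      ((l = some lp ∧ ex = nl) ∨ (l = none ∧ lp = nl ∧ ex = nl + 1)) ∧
      compileExpr ra (fun _ => none, C.2) ∅ (some lp) e = some (Pe, r, C₁) ∧
      compileCore D ra C₁ none (ex + 1) c = some (P₁, l₁, nl', C₂) ∧
      Pe ++ [((none, .jz ex r), C₁)] ++ P₁ ++ [((l₁, .jmp lp), C₂)] = Q ∧ some ex = l' ∧
      C₁ = C' := by
  have hlp : (l = some (l.getD nl) ∧ (if l.isSome then nl else nl + 1) = nl) ∨
      (l = none ∧ l.getD nl = nl ∧ (if l.isSome then nl else nl + 1) = nl + 1) := by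
    cases l <;> simp
  rw [compileCore] at h
  revert hlp h
  generalize l.getD nl = lp
  generalize (if l.isSome then nl else nl + 1) = ex
  intro h hlp
  split at h
  · cases h
  rename_i Pe r C₁ he
  split at h
  · cases h
  rename_i P₁ l₁ nl₁ C₂ hc
  cases h
  exact ⟨lp, ex, Pe, r, _, P₁, l₁, C₂, hlp, he, hc, rfl, rfl, rfl⟩

/-- Labels are drawn from an increasing counter, so apart from the inherited first label the
subtexts use disjoint intervals. -/
theorem compileCore_labels {D : Discipline L X V} {ra : RegAlloc X V R} {c : Cmd L X V}
    {C C' : CompRec X V R} {l l' : Option ℕ} {nl nl' : ℕ} {Q : CompText L X V R}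
    (h : compileCore D ra C l nl c = some (Q, l', nl', C')) (hl : ∀ x, l = some x → x < nl) :
    LabelsOK l nl Q l' nl' := by
  induction c generalizing C C' l l' nl nl' Q with
  | halt => rw [compileCore] at h; cases h
  | skip => rw [compileCore] at h; cases h; exact (LabelledBy.singleton _ _ _).labelsOK _
  | lockAcq k =>
    rw [compileCore] at h; cases h; exact (LabelledBy.singleton _ _ _).labelsOK _
  | lockRel k =>
    rw [compileCore] at h; cases h; exact (LabelledBy.singleton _ _ _).labelsOK _
  | assign v e =>
    rw [compileCore] at h
    split at h
    · cases h
    rename_i Pe r C₁ he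
    cases h
    exact (LabelledBy.snoc (compileExpr_labels he) _ _).labelsOK _
  | seq c₁ c₂ ih₁ ih₂ =>
    rw [compileCore] at h
    split at h
    · cases h
    rename_i P₁ l₁ nl₁ C₁ h₁
    split at h
    · cases h
    rename_i P₂ l₂ nl₂ C₂ h₂
    cases h
    have q₁ := ih₁ h₁ hl
    have q₂ := ih₂ h₂ fun x hx => (q₁.exit x hx).2.1
    have := q₁.le
    have := q₂.le
    refine ⟨by omega, ?_, fun i hi x hx => ?_, fun x hx => ?_⟩
    · obtain ⟨i, t, rfl, hi⟩ := q₁.head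
      exact ⟨i, t ++ P₂, rfl, hi⟩
    · rcases List.mem_append.1 hi with hi | hi
      · rcases q₁.mem i hi x hx with h | h
        · exact Or.inl h
        · right; omega
      · rcases q₂.mem i hi x hx with h | h
        · have := q₁.exit x h; right; omega
        · right; omega
    · obtain ⟨e₁, e₂, e₃⟩ := q₂.exit x hx
      refine ⟨by omega, e₂, fun i hi hix => ?_⟩
      rcases List.mem_append.1 hi with hi | hi
      · rcases q₁.mem i hi x hix with h | h
        · have := hl x h; omega
        · omega
      · exact e₃ i hi hix
  | ite e c₁ c₂ ih₁ ih₂ =>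
    rw [compileCore] at h
    split at h
    · cases h
    rename_i Pe r C₁ he
    split at h
    · cases h
    rename_i P₁ l₁ nl₁ C₂ h₁
    split at h
    · cases h
    rename_i P₂ l₂ nl₂ C₃ h₂
    cases h
    have q₀ := (LabelledBy.snoc (compileExpr_labels he) (.jz nl r) C₁).labelsOK nl
    have q₁ := ih₁ h₁ nofun
    have hle₁ := q₁.le
    have q₂ := ih₂ h₂ (by rintro x ⟨⟩; omega)
    have hle₂ := q₂.le
    -- The gap at `nl + 1` matters: this is the exit label, and no instruction of the text carries
    -- it.
    have hmem : ∀ i ∈ Pe ++ [((if Pe.isEmpty then l else none, .jz nl r), C₁)] ++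
        P₁ ++ [((l₁, .jmp (nl + 1)), C₂)] ++ P₂ ++ [((l₂, .nop), C₃)], ∀ x, i.1.1 = some x →
        l = some x ∨ x = nl ∨ (nl + 2 ≤ x ∧ x < nl') := by
      intro i hi x hx
      rw [List.mem_append, List.mem_append, List.mem_append, List.mem_append] at hi
      rcases hi with (((hi | hi) | hi) | hi) | hi
      · rcases q₀.mem i hi x hx with h | h
        · exact Or.inl h
        · omega
      · rcases q₁.mem i hi x hx with h | h
        · cases h
        · omega
      · obtain rfl := List.mem_singleton.1 hi
        have := q₁.exit x hx
        omega
      · rcases q₂.mem i hi x hx with h | h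
        · cases h; omega
        · omega
      · obtain rfl := List.mem_singleton.1 hi
        have := q₂.exit x hx
        omega
    refine ⟨by omega, ?_, fun i hi x hx => ?_, ?_⟩
    · obtain ⟨i, t, hit, hi⟩ := q₀.head
      simp only [hit, List.cons_append]
      exact ⟨i, _, rfl, hi⟩
    · rcases hmem i hi x hx with h | h | h
      · exact Or.inl h
      · omega
      · omega
    · rintro x ⟨⟩
      refine ⟨by omega, by omega, fun i hi hx => ?_⟩
      rcases hmem i hi _ hx with h | h | h
      · have := hl _ h; omega
      · omega
      · omega
  | loop e c ih =>
    obtain ⟨lp, ex, Pe, r, C₁, P₁, l₁, C₂, hlpx, he, h₁, rfl, rfl, rfl⟩ := compileCore_loop h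
    have hlt : lp < ex := by
      rcases hlpx with ⟨h, h'⟩ | h
      · have := hl lp h; omega
      · omega
    have qe := (compileExpr_labels he).resolve_left (compileExpr_ne_nil he)
    have q₀ := (qe.append (Q' := [((none, .jz ex r), C₁)]) (by simp)).labelsOK nl
    have q₁ := ih h₁ nofun
    have hle₁ := q₁.le
    have hmem : ∀ i ∈ Pe ++ [((none, .jz ex r), C₁)] ++ P₁ ++ [((l₁, .jmp lp), C₂)], ∀ x,
        i.1.1 = some x → x = lp ∨ (ex + 1 ≤ x ∧ x < nl') := by
      intro i hi x hx
      rw [List.mem_append, List.mem_append] at hi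
      rcases hi with (hi | hi) | hi
      · rcases q₀.mem i hi x hx with h | h
        · cases h; exact Or.inl rfl
        · omega
      · rcases q₁.mem i hi x hx with h | h
        · cases h
        · omega
      · obtain rfl := List.mem_singleton.1 hi
        have := q₁.exit x hx
        omega
    refine ⟨by omega, ?_, fun i hi x hx => ?_, ?_⟩
    · obtain ⟨i, t, hit, hi⟩ := q₀.head
      simp only [hit, List.cons_append]
      refine ⟨i, _, rfl, fun x hx => ?_⟩
      -- Without a prescribed label the first instruction still carries the fresh `lp`;
      -- `LabelsOK.head` constrains it only when `l` is present.
      rcases hlpx with ⟨h, -⟩ | ⟨h, -, -⟩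
      · exact hi x (h ▸ hx)
      · rw [h] at hx; cases hx
    · rcases hmem i hi x hx with rfl | h
      · rcases hlpx with ⟨h, -⟩ | ⟨-, h, -⟩
        · exact Or.inl h
        · omega
      · omega
    · rintro x ⟨⟩
      refine ⟨by omega, by omega, fun i hi hx => ?_⟩
      rcases hmem i hi _ hx with h | h <;> omega

/-! ### Compiled commands are simulated. -/

theorem LabelsOK.resolve_eq_zero {l l' : Option ℕ} {nl nl' x : ℕ} {Q : CompText L X V R}
    (h : LabelsOK l nl Q l' nl') (hx : l = some x) (post : List (Instr L X V R)) :
    resolve (Q.map Prod.fst ++ post) x = 0 := by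
  obtain ⟨i, t, rfl, hi⟩ := h.head
  simp [resolve, List.findIdx_cons, hi x hx]

/-- Jumps resolve in the whole text, so the induction is over code embedded between `pre` and
`post`. `hpre` ensures that no earlier instruction captures `l` or a label still to be issued, and
`hpost` that the requested exit label leads to the start of `post`. -/
theorem compileCore_sim {D : Discipline L X V} {ra : RegAlloc X V R} {c : Cmd L X V}
    {C C' : CompRec X V R} {l l' : Option ℕ} {nl nl' : ℕ} {Q : CompText L X V R}
    (h : compileCore D ra C l nl c = some (Q, l', nl', C')) (hl : ∀ x, l = some x → x < nl)
    (hst : StabilityChecks D c C.2)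
    {P pre post : List (Instr L X V R)} (hP : P = pre ++ Q.map Prod.fst ++ post) {pc pc' : ℕ}
    (hpc : pre.length = pc) (hpc' : pc + Q.length = pc')
    (hpre : ∀ i ∈ pre, ∀ x, i.1 = some x → x < nl ∧ l ≠ some x)
    (hpost : ∀ x, l' = some x → resolve post x = 0) :
    Sim D P c pc C pc' C' ∧ C'.2 = asmAfter D c C.2 := by
  induction c generalizing C C' l l' nl nl' Q pre post pc pc' with
  | halt => rw [compileCore] at h; cases h
  | skip =>
    rw [compileCore] at h; cases h; subst hpc'
    exact ⟨.skip _ _ l (getElem?_of_split (by simpa using hP) hpc), rfl⟩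
  | lockAcq k =>
    rw [compileCore] at h; cases h; subst hpc'
    exact ⟨.lockAcq _ _ _ l k (getElem?_of_split (by simpa using hP) hpc), rfl⟩
  | lockRel k =>
    rw [compileCore] at h; cases h; subst hpc'
    exact ⟨.lockRel _ _ _ l k (getElem?_of_split (by simpa using hP) hpc), rfl⟩
  | assign v e =>
    rw [compileCore] at h
    split at h
    · cases h
    rename_i Pe r C₁ he
    cases h
    simp only [List.length_append, List.length_cons, List.length_nil, zero_add, ← add_assoc] at hpc'
    subst hpc'
    generalize (if Pe.isEmpty = true then l else none) = lab at hP
    obtain ⟨s, hS, hr, -⟩ := compileExpr_straight D he hst.1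
      (post := (lab, .store v r) :: post) (by simpa using hP) hpc rfl
    refine ⟨?_, hS⟩
    rw [hS]
    exact .assign pc C.1 C.2 _ _ lab v e r s (getElem?_of_split (Q₁ := pre ++ Pe.map Prod.fst)
      (by simpa using hP) (by simpa using hpc)) hr
  | seq c₁ c₂ ih₁ ih₂ =>
    rw [compileCore] at h
    split at h
    · cases h
    rename_i P₁ l₁ nl₁ C₁ h₁
    split at h
    · cases h
    rename_i P₂ l₂ nl₂ C₂ h₂
    cases h
    have q₁ := compileCore_labels h₁ hl
    have hl₁ : ∀ x, l₁ = some x → x < nl₁ := fun x hx => (q₁.exit x hx).2.1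
    have q₂ := compileCore_labels h₂ hl₁
    have hle₁ := q₁.le
    obtain ⟨s₁, S₁⟩ := ih₁ h₁ hl hst.1 (pre := pre) (post := P₂.map Prod.fst ++ post)
      (by simpa using hP) hpc rfl hpre fun x hx => q₂.resolve_eq_zero hx _
    obtain ⟨s₂, S₂⟩ := ih₂ h₂ hl₁ (S₁ ▸ hst.2) (pre := pre ++ P₁.map Prod.fst) (post := post)
      (by simpa using hP) (pc := pc + P₁.length) (by simp [hpc]) (by simpa [add_assoc] using hpc')
      (by
        intro i hi x hx
        rcases List.mem_append.1 hi with hi | hi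
        · have := hpre i hi x hx
          refine ⟨by omega, fun h => ?_⟩
          have := q₁.exit x h
          omega
        · obtain ⟨j, hj, rfl⟩ := List.mem_map.1 hi
          refine ⟨?_, fun h => (q₁.exit x h).2.2 j hj hx⟩
          rcases q₁.mem j hj x hx with h | h
          · have := hl x h; omega
          · omega) hpost
    exact ⟨.seq _ _ _ _ _ _ _ _ s₁ s₂, by rw [S₂, S₁]; rfl⟩
  | ite e c₁ c₂ ih₁ ih₂ =>
    rw [compileCore] at h
    split at h
    · cases h
    rename_i Pe r C₁ he
    split at h
    · cases h
    rename_i P₁ l₁ nl₁ C₂ h₁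
    split at h
    · cases h
    rename_i P₂ l₂ nl₂ C₃ h₂
    cases h
    obtain ⟨he', hst₁, hst₂, hasm⟩ := hst
    have q₀ := (LabelledBy.snoc (compileExpr_labels he) (.jz nl r) C₁).labelsOK nl
    have q₁ := compileCore_labels h₁ nofun
    have hle₁ := q₁.le
    have hnl : ∀ x, some nl = some x → x < nl₁ := by rintro x ⟨⟩; omega
    have q₂ := compileCore_labels h₂ hnl
    have hle₂ := q₂.le
    generalize (if Pe.isEmpty = true then l else none) = lab at hP q₀
    simp only [List.map_append, List.map_cons, List.map_nil, List.append_assoc,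
      List.cons_append, List.nil_append] at hP
    simp only [List.length_append, List.length_cons, List.length_nil, zero_add,
      ← add_assoc] at hpc'
    -- the labels before each of the two branches
    have hpre₀ : ∀ i ∈ pre ++ Pe.map Prod.fst ++ [(lab, .jz nl r)], ∀ x, i.1 = some x → x < nl := by
      intro i hi x hx
      rw [List.append_assoc] at hi
      rcases List.mem_append.1 hi with hi | hi
      · exact (hpre i hi x hx).1
      · obtain ⟨j, hj, rfl⟩ : ∃ j ∈ Pe ++ [((lab, .jz nl r), C₁)], j.1 = i := by
          simpa [eq_comm] using hi
        rcases q₀.mem j hj x hx with h | h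
        · exact hl x h
        · omega
    have hpre₁ : ∀ i ∈ pre ++ Pe.map Prod.fst ++ [(lab, .jz nl r)] ++ P₁.map Prod.fst ++
        [(l₁, .jmp (nl + 1))], ∀ x, i.1 = some x → x < nl ∨ (nl + 2 ≤ x ∧ x < nl₁) := by
      intro i hi x hx
      rw [List.append_assoc _ _ [_]] at hi
      rcases List.mem_append.1 hi with hi | hi
      · exact Or.inl (hpre₀ i hi x hx)
      · rcases List.mem_append.1 hi with hi | hi
        · obtain ⟨j, hj, rfl⟩ := List.mem_map.1 hi
          rcases q₁.mem j hj x hx with h | h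
          · cases h
          · exact Or.inr h
        · obtain rfl := List.mem_singleton.1 hi
          have := q₁.exit x hx
          omega
    obtain ⟨s, hS, hr, -⟩ := compileExpr_straight D he he' (pre := pre) (by simpa using hP) hpc rfl
    obtain ⟨s₁, S₁⟩ := ih₁ h₁ nofun (hS ▸ hst₁)
      (pre := pre ++ Pe.map Prod.fst ++ [(lab, .jz nl r)])
      (post := (l₁, .jmp (nl + 1)) :: (P₂.map Prod.fst ++ (l₂, .nop) :: post))
      (pc := pc + Pe.length + 1)
      (by simpa using hP)
      (by simp [hpc]; omega) rfl
      (fun i hi x hx => ⟨by have := hpre₀ i hi x hx; omega, nofun⟩)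
      (fun x hx => by simp [resolve, List.findIdx_cons, hx])
    obtain ⟨s₂, S₂⟩ := ih₂ h₂ hnl (hS ▸ hst₂)
      (pre := pre ++ Pe.map Prod.fst ++ [(lab, .jz nl r)] ++ P₁.map Prod.fst ++
        [(l₁, .jmp (nl + 1))])
      (post := (l₂, .nop) :: post)
      (pc := pc + Pe.length + 1 + P₁.length + 1)
      (by simpa using hP)
      (by simp only [List.length_append, List.length_map, List.length_cons, List.length_nil]; omega) rfl
      (fun i hi x hx => by
        have := hpre₁ i hi x hx
        refine ⟨by omega, ?_⟩
        rintro ⟨⟩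
        omega)
      (fun x hx => by simp [resolve, List.findIdx_cons, hx])
    -- Labels before the second branch are below `nl` or at least `nl + 2`, and that branch starts
    -- with `nl`.
    have hbr : resolve P nl = pc + Pe.length + 1 + P₁.length + 1 := by
      have hP' : P = (pre ++ Pe.map Prod.fst ++ [(lab, .jz nl r)] ++ P₁.map Prod.fst ++
        [(l₁, .jmp (nl + 1))]) ++ (P₂.map Prod.fst ++ (l₂, .nop) :: post) := by simpa using hP
      rw [hP', resolve_append, q₂.resolve_eq_zero rfl, add_zero]
      · simp only [List.length_append, List.length_map, List.length_cons, List.length_nil]; omega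
      intro i hi hx
      have := hpre₁ i hi _ hx
      omega
    have hex : resolve P (nl + 1) = pc' := by
      have hP' : P = (pre ++ Pe.map Prod.fst ++ [(lab, .jz nl r)] ++ P₁.map Prod.fst ++
        [(l₁, .jmp (nl + 1))] ++ P₂.map Prod.fst ++ [(l₂, .nop)]) ++ post := by simpa using hP
      rw [hP', resolve_append, hpost _ rfl]
      · simp only [List.length_append, List.length_map, List.length_cons, List.length_nil]; omega
      intro i hi hx
      rw [List.append_assoc _ _ [_]] at hi
      rcases List.mem_append.1 hi with hi | hi
      · have := hpre₁ i hi _ hx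
        omega
      · rcases List.mem_append.1 hi with hi | hi
        · obtain ⟨j, hj, rfl⟩ := List.mem_map.1 hi
          rcases q₂.mem j hj _ hx with h | h
          · cases h
          · omega
        · obtain rfl := List.mem_singleton.1 hi
          have := q₂.exit _ hx
          omega
    have hC : C₂.2 = C₃.2 := by rw [S₁, S₂, hS, hasm]
    -- `Sim.ite` needs a common endpoint: the first branch gets there by its jump, the second
    -- through the final no-op, and both records are weakened to the entries they share.
    have s₁' := (s₁.jmp _ _ _ _ _ l₁ (nl + 1) (getElem?_of_split
      (Q₁ := pre ++ Pe.map Prod.fst ++ [(lab, .jz nl r)] ++ P₁.map Prod.fst)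
      (by simpa using hP) (by simp only [List.length_append, List.length_map, List.length_cons, List.length_nil]; omega))).weaken _ _ _ _ _
      (C₂.1.meet C₃.1, C₂.2) ⟨rfl, fun r e h => (RegRec.meet_le h).1⟩
    have s₂' := (s₂.nop _ _ _ _ _ l₂ (getElem?_of_split
      (Q₁ := pre ++ Pe.map Prod.fst ++ [(lab, .jz nl r)] ++ P₁.map Prod.fst ++
        [(l₁, .jmp (nl + 1))] ++ P₂.map Prod.fst) (Q₂ := post)
      (by simpa using hP) (by simp only [List.length_append, List.length_map, List.length_cons, List.length_nil]; omega))).weaken _ _ _ _ _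
      (C₂.1.meet C₃.1, C₂.2) ⟨hC, fun r e h => (RegRec.meet_le h).2⟩
    rw [hex] at s₁'
    rw [hpc'] at s₂'
    refine ⟨.ite e c₁ c₂ pc C.1 C.2 _ C₁.1 lab nl r _ _ s (getElem?_of_split
      (Q₁ := pre ++ Pe.map Prod.fst) (by simpa using hP) (by simpa using hpc)) hr
      (hS ▸ s₁') (hbr ▸ hS ▸ s₂'), ?_⟩
    · rw [S₁, hS]; rfl
  | loop e c ih =>
    obtain ⟨lp, ex, Pe, r, C₁, P₁, l₁, C₂, hlpx, he, h₁, rfl, rfl, rfl⟩ := compileCore_loop h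
    have hlt : lp < ex := by
      rcases hlpx with ⟨h, h'⟩ | h
      · have := hl lp h; omega
      · omega
    obtain ⟨he', hstc, hasm⟩ := hst
    have qe := (compileExpr_labels he).resolve_left (compileExpr_ne_nil he)
    have q₁ := compileCore_labels h₁ nofun
    have hle₁ := q₁.le
    simp only [List.map_append, List.map_cons, List.map_nil, List.append_assoc,
      List.cons_append, List.nil_append] at hP
    simp only [List.length_append, List.length_cons, List.length_nil, zero_add,
      ← add_assoc] at hpc'
    have hpre₀ : ∀ i ∈ pre ++ Pe.map Prod.fst ++ [(none, .jz ex r)], ∀ x, i.1 = some x →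
        x < ex := by
      intro i hi x hx
      rw [List.append_assoc] at hi
      rcases List.mem_append.1 hi with hi | hi
      · have := hpre i hi x hx; omega
      · obtain ⟨j, hj, rfl⟩ : ∃ j ∈ Pe ++ [((none, .jz ex r), C₁)], j.1 = i := by
          simpa [eq_comm] using hi
        rcases ((qe.append (Q' := [((none, .jz ex r), C₁)]) (by simp)).labelsOK nl).mem j hj x hx
          with h | h
        · cases h; omega
        · omega
    obtain ⟨s, hS, hr, -⟩ := compileExpr_straight D he he' (pre := pre) (by simpa using hP) hpc rfl
    obtain ⟨s₁, S₁⟩ := ih h₁ nofun (hS ▸ hstc)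
      (pre := pre ++ Pe.map Prod.fst ++ [(none, .jz ex r)])
      (post := (l₁, .jmp lp) :: post)
      (pc := pc + Pe.length + 1)
      (by simpa using hP)
      (by simp [hpc]; omega) rfl
      (fun i hi x hx => ⟨by have := hpre₀ i hi x hx; omega, nofun⟩)
      (fun x hx => by simp [resolve, List.findIdx_cons, hx])
    -- An inherited head label is older than `nl`; that it does not occur earlier is the second half
    -- of `hpre`. A fresh one equals `nl`, which exceeds all earlier labels.
    have hhead : resolve P lp = pc := by
      rw [hP, resolve_append, (qe.labelsOK nl).resolve_eq_zero rfl, add_zero, hpc]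
      intro i hi hx
      obtain ⟨hlt, hne⟩ := hpre i hi _ hx
      rcases hlpx with ⟨h, -⟩ | ⟨-, h, -⟩
      · exact hne h
      · omega
    have hexit : resolve P ex = pc' := by
      have hP' : P = (pre ++ Pe.map Prod.fst ++ [(none, .jz ex r)] ++ P₁.map Prod.fst ++
        [(l₁, .jmp lp)]) ++ post := by simpa using hP
      rw [hP', resolve_append, hpost _ rfl]
      · simp only [List.length_append, List.length_map, List.length_cons, List.length_nil]; omega
      intro i hi hx
      rw [List.append_assoc _ _ [_]] at hi
      rcases List.mem_append.1 hi with hi | hi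
      · have := hpre₀ i hi _ hx
        omega
      · rcases List.mem_append.1 hi with hi | hi
        · obtain ⟨j, hj, rfl⟩ := List.mem_map.1 hi
          rcases q₁.mem j hj _ hx with h | h
          · cases h
          · omega
        · obtain rfl := List.mem_singleton.1 hi
          have := q₁.exit _ hx
          omega
    have s₁' := s₁.jmp _ _ _ _ _ l₁ lp (getElem?_of_split
      (Q₁ := pre ++ Pe.map Prod.fst ++ [(none, .jz ex r)] ++ P₁.map Prod.fst) (Q₂ := post)
      (by simpa using hP) (by simp only [List.length_append, List.length_map, List.length_cons, List.length_nil]; omega))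
    have hC₁ : C₁ = (C₁.1, C.2) := Prod.ext rfl hS
    have hC₂ : C₂ = (C₂.1, C.2) := Prod.ext rfl (by rw [S₁, hS]; exact hasm)
    rw [hhead, hC₁, hC₂] at s₁'
    refine ⟨?_, hS⟩
    rw [← hexit, hC₁]
    exact .loop e c pc C.1 C.2 _ C₁.1 none ex r C₂.1 s (getElem?_of_split
      (Q₁ := pre ++ Pe.map Prod.fst) (by simpa using hP) (by simpa using hpc)) hr s₁'

end CompilerCorrectness

end WR

theorem mainTheorem2 {L X V R : Type*} [Zero V]
    (D : WR.Discipline L X V) (ra : WR.RegAlloc X V R)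
    (c : WR.Cmd L X V) (regs : R → V)
    (l : Option ℕ) (nl : ℕ)
    (PCs : WR.CompText L X V R) (l' : Option ℕ) (nl' : ℕ) (C' : WR.CompRec X V R)
    (hsec : WR.ComSecure D.cl (WR.WhileStep D) (WR.NoLocksHeld D) WR.NoHighBranching
      c (WR.initMds D))
    (hcomp : (PCs, l', nl', C', false) =
      WR.compileCmd D ra (WR.initCompRec X V R) l nl c)
    (hreq : WR.CompilerInputReqs D (WR.initCompRec X V R) l nl c) :
    WR.ComSecure D.cl (WR.RiscStep D) (WR.NoLocksHeld D) WR.PCSecurity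
      ((0, PCs.map Prod.fst), regs) (WR.initMds D) := by
  rw [WR.compileCmd, if_pos hreq] at hcomp
  split at hcomp
  · rename_i h
    cases hcomp
    -- Nothing surrounds the whole text: in an empty `post` every label resolves to 0, so a leftover
    -- exit label denotes the end of the program. The empty record is correct for all memories and
    -- registers since the initial modes make no assumptions.
    refine WR.comSecure_of_sim hsec (WR.compileCore_sim h hreq.2.2.2 hreq.1 (pre := []) (post := [])
      (by simp) rfl (by simp) (by simp) fun _ _ => rfl).1 fun mem => ⟨nofun, hreq.2.1, ?_, ?_⟩ <;>
    simp [WR.initCompRec, WR.initMds]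
  · cases hcomp
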